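/- Let $\mathcal{A}$ be a semi-abelian category (pointed, Barr exact, Bourn protomodular, with binary coproducts) with enough regular projectives. A Birkhoff subcategory of a category is a full reflective subcategory closed under subobjects and regular quotients. *Conventions.* For a Birkhoff subcategory with reflector $I$, unit $\eta$ and $[X,X]_I=\mathrm{Ker}(\eta_X)$: an extension is a regular epimorphism; an extension is $I$-trivial if its $\eta$-naturality square is a pullback, and $I$-central if its pullback along some extension is $I$-trivial; a universal $I$-central extension of $A$ is an initial object among the $I$-central extensions of $A$; $X$ is $I$-perfect if $I(X)=0$. For a projective presentation $f\colon X\to A$ with kernel $K$ and kernel pair projections $f_0,f_1$, let $[K,X]_I=\mathrm{Ker}([f_0,f_0]_I)$, mapped to $[X,X]_I$ by $[f_1,f_1]_I$, and put $$\mathrm{U}(A,I)=\frac{[X,X]_I}{[K,X]_I},\qquad \mathrm{H}_2(A,I)=\frac{K\wedge [X,X]_I}{[K,X]_I},$$ with $u_A^I\colon \mathrm{U}(A,I)\to A$ induced by $f$. For $I$-perfect $A$, $u^I_A$ is the universal $I$-central extension of $A$. Let $\mathsf{Ab}(\mathcal{A})$ be the full subcategory of the objects that admit an internal abelian group structure,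 and assume condition (UCE): whenever $B$ is $\mathsf{Ab}(\mathcal{A})$-perfect and $f\colon B\to A$, $g\colon C\to B$ are $\mathsf{Ab}(\mathcal{A})$-central extensions, $f\circ g$ is an $\mathsf{Ab}(\mathcal{A})$-central extension. *Statement.* Let $\mathsf{Ab}(\mathcal{A})\subseteq\mathcal{C}\subseteq\mathcal{B}\subseteq\mathcal{A}$ be Birkhoff subcategories of $\mathcal{A}$, with reflectors $I\colon\mathcal{A}\to\mathcal{B}$ (unit $\eta^I$), $J\colon\mathcal{B}\to\mathcal{C}$ and $JI\colon\mathcal{A}\to\mathcal{C}$, and let $B$ be a $J$-perfect object of $\mathcal{B}$. Form $u_B^J\colon\mathrm{U}(B,J)\to B$ in $\mathcal{B}$, and $u_B^{JI}\colon\mathrm{U}(B,JI)\to B$ in $\mathcal{A}$, from arbitrary projective presentations. Then $u_B^{JI}$ is a universal $JI$-central extension in $\mathcal{A}$, $u_B^J$ is a universal $J$-central extension in $\mathcal{B}$, and: 1. There is an isomorphism $\theta\colon I(\mathrm{U}(B,JI))\to\mathrm{U}(B,J)$ such that $u_B^J\circ\theta\circ\eta^I_{\mathrm{U}(B,JI)}=u_B^{JI}$,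 and $\theta\circ\eta^I_{\mathrm{U}(B,JI)}\colon \mathrm{U}(B,JI)\to\mathrm{U}(B,J)$ is a universal $JI$-central extension of $\mathrm{U}(B,J)$, isomorphic over $\mathrm{U}(B,J)$ to $u^{JI}_{\mathrm{U}(B,J)}$. 2. $[\mathrm{U}(B,JI),\mathrm{U}(B,JI)]_{\mathcal{B}}\cong \mathrm{H}_2(\mathrm{U}(B,J),JI)$, where $[X,X]_{\mathcal{B}}=\mathrm{Ker}(\eta^I_X)$. 3. The following are equivalent: (a) $u_B^{JI}$ and $u_B^J$ are isomorphic over $B$; (b) $\eta^I_{\mathrm{U}(B,JI)}$ is an isomorphism; (c) $\mathrm{H}_2(\mathrm{U}(B,J),JI)=0$. -/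

import Mathlib

open CategoryTheory CategoryTheory.Limits

universe v u

namespace CentralExt

/-! ### Semi-abelian categories -/

section SemiAbelian

/-- The regular short five lemma: for a morphism `(b, a)` from a regular epimorphism `f'` to a
regular epimorphism `f`, if `a` and the induced morphism between the kernels are isomorphisms,
then so is `b`.  For pointed regular categories this is Bourn protomodularity. -/
def RegularShortFiveLemma (𝒜 : Type u) [Category.{v} 𝒜] [HasZeroMorphisms 𝒜] [HasKernels 𝒜] :
    Prop :=
  ∀ ⦃B' A' B A : 𝒜⦄ (f' : B' ⟶ A') (f : B ⟶ A) (b : B' ⟶ B) (a : A' ⟶ A)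
    (w : f' ≫ a = b ≫ f), IsRegularEpi f' → IsRegularEpi f → IsIso a →
    IsIso (kernel.map f' f b a w) → IsIso b

/-- A semi-abelian category: pointed, Barr exact (regular, with every internal equivalence
relation a kernel pair), Bourn protomodular, with binary coproducts. -/
class SemiAbelian (𝒜 : Type u) [Category.{v} 𝒜] [HasZeroMorphisms 𝒜] : Prop where
  hasZeroObject : HasZeroObject 𝒜
  regular : Regular 𝒜
  isKernelPair_of_isEquivalenceRelation : ∀ ⦃R X : 𝒜⦄ (p₁ p₂ : R ⟶ X),
    IsEquivalenceRelation p₁ p₂ → ∃ (Y : 𝒜) (f : X ⟶ Y), IsKernelPair f p₁ p₂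
  shortFive : RegularShortFiveLemma 𝒜
  hasBinaryCoproducts : HasBinaryCoproducts 𝒜

attribute [instance] SemiAbelian.hasZeroObject SemiAbelian.regular
  SemiAbelian.hasBinaryCoproducts

attribute [local simp] prod.lift_fst prod.lift_snd prod.lift_fst_assoc prod.lift_snd_assoc
  pullback.lift_fst pullback.lift_snd pullback.lift_fst_assoc pullback.lift_snd_assoc
  coprod.inl_desc coprod.inr_desc coprod.inl_desc_assoc coprod.inr_desc_assoc
  coequalizer.π_desc kernel.lift_ι kernel.lift_ι_assoc

/-- A split epimorphism is a regular epimorphism. -/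
lemma isRegularEpi_of_section {𝒜 : Type u} [Category.{v} 𝒜] {B A : 𝒜} (f : B ⟶ A) (s : A ⟶ B) (h : s ≫ f = 𝟙 A) :
    IsRegularEpi f := by
  have : IsSplitEpi f := ⟨⟨⟨s, h⟩⟩⟩
  infer_instance

variable {𝒜 : Type u} [Category.{v} 𝒜] [HasZeroMorphisms 𝒜]

/-- In a semi-abelian category, a monomorphism into the domain of a split epimorphism is an
isomorphism as soon as the kernel and the section factor through it. -/
lemma isIso_of_kernel_of_section [SemiAbelian 𝒜] {M B A : 𝒜} (f : B ⟶ A) (s : A ⟶ B)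
    (hs : s ≫ f = 𝟙 A) (m : M ⟶ B) [Mono m] (s' : A ⟶ M) (hs' : s' ≫ m = s)
    (k' : kernel f ⟶ M) (hk' : k' ≫ m = kernel.ι f) : IsIso m := by
  have w : (m ≫ f) ≫ 𝟙 A = m ≫ f := by simp
  refine SemiAbelian.shortFive (m ≫ f) f m (𝟙 A) w
    (isRegularEpi_of_section _ s' (by rw [← Category.assoc, hs', hs]))
    (isRegularEpi_of_section _ s hs) inferInstance ?_
  refine ⟨kernel.lift (m ≫ f) k' (by rw [← Category.assoc, hk', kernel.condition]), ?_, ?_⟩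
  · rw [← cancel_mono (kernel.ι (m ≫ f)), ← cancel_mono m]
    simp [hk']
  · rw [← cancel_mono (kernel.ι f)]
    simp [hk']

/-- Relations in a semi-abelian category are difunctional: from `x R y`, `x' R y` and
`x' R y'` it follows that `x R y'`. -/
lemma difunctional [SemiAbelian 𝒜] {R X : 𝒜} {p₁ p₂ : R ⟶ X}
    (hmono : JointlyMono₂ p₁ p₂) {T : 𝒜} (a b c : T ⟶ R)
    (hab : a ≫ p₂ = b ≫ p₂) (hbc : b ≫ p₁ = c ≫ p₁) :
    ∃ d : T ⟶ R, d ≫ p₁ = a ≫ p₁ ∧ d ≫ p₂ = c ≫ p₂ := by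
  have hm : Mono (prod.lift p₁ p₂) := ⟨fun g h e => hmono.right_cancellation _ _
    (by simpa using congrArg (· ≫ prod.fst) e) (by simpa using congrArg (· ≫ prod.snd) e)⟩
  let g : pullback p₂ p₂ ⟶ X := pullback.snd p₂ p₂ ≫ p₁
  let f := pullback.fst g p₁
  let s : pullback p₂ p₂ ⟶ pullback g p₁ := pullback.lift (𝟙 _) (pullback.snd p₂ p₂) (by simp [g])
  let t : pullback g p₁ ⟶ X ⨯ X :=
    prod.lift (f ≫ pullback.fst p₂ p₂ ≫ p₁) (pullback.snd g p₁ ≫ p₂)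
  let m := pullback.fst t (prod.lift p₁ p₂)
  have hiso : IsIso m := by
    refine isIso_of_kernel_of_section f s (by simp [s, f]) m
      (pullback.lift s (pullback.fst p₂ p₂) ?_) (pullback.lift_fst _ _ _)
      (pullback.lift (kernel.ι f) (kernel.ι f ≫ pullback.snd g p₁) ?_) (pullback.lift_fst _ _ _)
    · apply prod.hom_ext
      · simp [t, s, f]
      · simp [t, s, f, pullback.condition]
    · have h0 : kernel.ι f ≫ f = 0 := kernel.condition f
      apply prod.hom_ext
      · have : pullback.snd g p₁ ≫ p₁ = f ≫ g := pullback.condition.symm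
        simp only [t, Category.assoc, prod.lift_fst, this]
        rw [reassoc_of% h0, reassoc_of% h0]
        simp
      · simp [t]
  let x : T ⟶ pullback g p₁ := pullback.lift (pullback.lift a b hab) c (by simp [g, hbc])
  have hx : (x ≫ inv m ≫ pullback.snd t (prod.lift p₁ p₂)) ≫ prod.lift p₁ p₂ = x ≫ t := by
    rw [Category.assoc, Category.assoc, ← pullback.condition]
    simp [m]
  refine ⟨x ≫ inv m ≫ pullback.snd t (prod.lift p₁ p₂), ?_, ?_⟩
  · have := congrArg (· ≫ prod.fst) hx
    simpa [x, t, f] using this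
  · have := congrArg (· ≫ prod.snd) hx
    simpa [x, t, f] using this

/-- In a semi-abelian category, reflexive relations are equivalence relations. -/
lemma isEquivalenceRelation_of_reflexive [SemiAbelian 𝒜] {R X : 𝒜} {p₁ p₂ : R ⟶ X}
    (hmono : JointlyMono₂ p₁ p₂) (r : X ⟶ R) (h₁ : r ≫ p₁ = 𝟙 X) (h₂ : r ≫ p₂ = 𝟙 X) :
    IsEquivalenceRelation p₁ p₂ := by
  obtain ⟨s, hs₁, hs₂⟩ := difunctional hmono (p₂ ≫ r) (𝟙 R) (p₁ ≫ r)
    (by simp [h₂]) (by simp [h₁])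
  obtain ⟨t, ht₁, ht₂⟩ := difunctional hmono (pullback.fst p₂ p₁)
    (pullback.fst p₂ p₁ ≫ p₂ ≫ r) (pullback.snd p₂ p₁) (by simp [h₂])
    (by simp [h₁, pullback.condition])
  exact ⟨⟨{ right_cancellation := hmono.right_cancellation
            r := r
            reflexivity₁ := h₁
            reflexivity₂ := h₂
            s := s
            symmetry₁ := by simpa [h₁] using hs₁
            symmetry₂ := by simpa [h₂] using hs₂
            c := PullbackCone.mk _ _ pullback.condition
            isLimit := pullbackIsPullback p₂ p₁
            t := t
            transitivity₁ := ht₁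
            transitivity₂ := ht₂ }⟩⟩

/-- Semi-abelian categories have coequalizers. -/
instance hasCoequalizers_of_semiAbelian [SemiAbelian 𝒜] : HasCoequalizers 𝒜 := by
  apply +allowSynthFailures hasCoequalizers_of_hasColimit_parallelPair
  intro X Y f g
  let l : X ⨿ Y ⟶ Y ⨯ Y := prod.lift (coprod.desc f (𝟙 Y)) (coprod.desc g (𝟙 Y))
  let F := Regular.strongEpiMonoFactorisation l
  let p₁ : F.I ⟶ Y := F.m ≫ prod.fst
  let p₂ : F.I ⟶ Y := F.m ≫ prod.snd
  have he₁ : F.e ≫ p₁ = coprod.desc f (𝟙 Y) := by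
    simp only [p₁, ← Category.assoc, F.fac]; simp [l]
  have he₂ : F.e ≫ p₂ = coprod.desc g (𝟙 Y) := by
    simp only [p₂, ← Category.assoc, F.fac]; simp [l]
  have hmono : JointlyMono₂ p₁ p₂ := ⟨fun Z a b h h' => by
    rw [← cancel_mono F.m]
    apply prod.hom_ext
    · simpa [p₁] using h
    · simpa [p₂] using h'⟩
  have hrel : IsEquivalenceRelation p₁ p₂ :=
    isEquivalenceRelation_of_reflexive hmono (coprod.inr ≫ F.e)
      (by rw [Category.assoc, he₁]; simp) (by rw [Category.assoc, he₂]; simp)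
  obtain ⟨Z, h, hk⟩ := SemiAbelian.isKernelPair_of_isEquivalenceRelation p₁ p₂ hrel
  have : HasCoequalizer p₁ p₂ := Regular.hasCoequalizer_of_isKernelPair hk
  have hf : coprod.inl ≫ F.e ≫ p₁ = f := by rw [he₁]; simp
  have hg : coprod.inl ≫ F.e ≫ p₂ = g := by rw [he₂]; simp
  have hfg : f ≫ coequalizer.π p₁ p₂ = g ≫ coequalizer.π p₁ p₂ := by
    have hc : p₁ ≫ coequalizer.π p₁ p₂ = p₂ ≫ coequalizer.π p₁ p₂ := coequalizer.condition p₁ p₂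
    rw [← hf, ← hg]
    exact (Category.assoc _ _ _).trans ((congrArg (coprod.inl ≫ ·) ((Category.assoc _ _ _).trans
      ((congrArg (F.e ≫ ·) hc).trans (Category.assoc _ _ _).symm))).trans
      (Category.assoc _ _ _).symm)
  refine ⟨⟨⟨Cofork.ofπ (coequalizer.π p₁ p₂) hfg, ?_⟩⟩⟩
  refine Cofork.IsColimit.mk' _ fun c => ⟨coequalizer.desc (f := p₁) (g := p₂) c.π ?_,
    coequalizer.π_desc _ _, fun {m} hm => ?_⟩
  · rw [← cancel_epi F.e, reassoc_of% he₁, reassoc_of% he₂]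
    apply coprod.hom_ext
    · simpa using c.condition
    · simp
  · exact coequalizer.hom_ext (f := p₁) (g := p₂) (hm.trans (coequalizer.π_desc _ _).symm)

end SemiAbelian

/-! ### Reflections and Birkhoff subcategories -/

section Birkhoff

variable {𝒜 : Type u} [Category.{v} 𝒜] (P : ObjectProperty 𝒜)

/-- `η : X ⟶ Y` is a reflection of `X` in the full subcategory of objects satisfying `P`. -/
def IsReflection {X Y : 𝒜} (η : X ⟶ Y) : Prop :=
  P Y ∧ ∀ ⦃Z : 𝒜⦄, P Z → ∀ g : X ⟶ Z, ∃! h : Y ⟶ Z, η ≫ h = g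

/-- The objects satisfying `P` form a Birkhoff subcategory: a full reflective subcategory closed
under subobjects and regular quotients. -/
class IsBirkhoff : Prop extends P.IsClosedUnderSubobjects where
  isRightAdjoint : P.ι.IsRightAdjoint
  of_isRegularEpi : ∀ ⦃X Y : 𝒜⦄ (f : X ⟶ Y), IsRegularEpi f → P X → P Y

attribute [instance] IsBirkhoff.isRightAdjoint

section

variable [P.ι.IsRightAdjoint]

/-- The reflector onto the subcategory `P`, regarded as an endofunctor of the ambient category. -/
noncomputable def reflection : 𝒜 ⥤ 𝒜 := P.ι.leftAdjoint ⋙ P.ι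

/-- The unit `η` of the reflection. -/
noncomputable def reflUnit (X : 𝒜) : X ⟶ (reflection P).obj X := (Adjunction.ofIsRightAdjoint P.ι).unit.app X

lemma reflUnit_naturality {X Y : 𝒜} (f : X ⟶ Y) : reflUnit P X ≫ (reflection P).map f = f ≫ reflUnit P Y :=
  ((Adjunction.ofIsRightAdjoint P.ι).unit.naturality f).symm

lemma isReflection_reflUnit (X : 𝒜) : IsReflection P (reflUnit P X) := by
  refine ⟨P.prop_ι_obj _, fun Z hZ g => ?_⟩
  let adj := Adjunction.ofIsRightAdjoint P.ι
  let Z' : P.FullSubcategory := ⟨Z, hZ⟩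
  refine ⟨((adj.homEquiv X Z').symm g).hom, ?_, fun h hh => ?_⟩
  · have := (adj.homEquiv X Z').apply_symm_apply g
    rwa [adj.homEquiv_unit] at this
  · have : (adj.homEquiv X Z').symm g = ObjectProperty.homMk h := by
      rw [Equiv.symm_apply_eq, adj.homEquiv_unit]
      exact hh.symm
    rw [this]
    rfl

end

/-- An inclusion is a right adjoint as soon as every object has a reflection. -/
lemma isRightAdjoint_of_isReflection
    (h : ∀ X : 𝒜, ∃ (Y : 𝒜) (η : X ⟶ Y), IsReflection P η) : P.ι.IsRightAdjoint := by
  rw [isRightAdjoint_iff_hasInitial_structuredArrow]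
  intro X
  obtain ⟨Y, η, hY, hη⟩ := h X
  let Y' : P.FullSubcategory := ⟨Y, hY⟩
  have : ∀ T : StructuredArrow X P.ι, Nonempty (Unique (StructuredArrow.mk (Y := Y') η ⟶ T)) := by
    intro T
    obtain ⟨k, hk, huniq⟩ := hη T.right.property T.hom
    refine ⟨⟨⟨StructuredArrow.homMk (ObjectProperty.homMk k) hk⟩, fun m => ?_⟩⟩
    ext
    exact huniq _ (StructuredArrow.w m)
  exact (IsInitial.ofUnique (h := fun T => (this T).some) (StructuredArrow.mk (Y := Y') η)).hasInitial

end Birkhoff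

/-! ### Full subcategories of pointed categories -/

section FullSubcategory

variable {𝒜 : Type u} [Category.{v} 𝒜] (P : ObjectProperty 𝒜)

noncomputable instance fullSubcategoryHasZeroMorphisms [HasZeroMorphisms 𝒜] :
    HasZeroMorphisms P.FullSubcategory where
  zero X Y := ⟨ObjectProperty.homMk 0⟩
  comp_zero f Z := by ext; exact comp_zero
  zero_comp X {Y Z} f := by ext; exact zero_comp

instance fullSubcategoryHasFiniteLimits [P.ι.IsRightAdjoint] [HasFiniteLimits 𝒜] :
    HasFiniteLimits P.FullSubcategory where
  out J _ _ := by
    let _ : Reflective P.ι := { L := P.ι.leftAdjoint, adj := Adjunction.ofIsRightAdjoint P.ι }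
    exact hasLimitsOfShape_of_reflective P.ι

instance fullSubcategoryHasCoequalizers [P.ι.IsRightAdjoint] [HasCoequalizers 𝒜] :
    HasCoequalizers P.FullSubcategory := by
  let _ : Reflective P.ι := { L := P.ι.leftAdjoint, adj := Adjunction.ofIsRightAdjoint P.ι }
  exact hasColimitsOfShape_of_reflective P.ι

/-- The objects of `𝒞` that lie in `ℬ`, as a property of objects of the full subcategory `ℬ`. -/
abbrev within (𝒞 ℬ : ObjectProperty 𝒜) : ObjectProperty ℬ.FullSubcategory := 𝒞.inverseImage ℬ.ι

/-- The unit of a Birkhoff subcategory is a regular epimorphism. -/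
lemma isRegularEpi_reflUnit [Regular 𝒜] [IsBirkhoff P] (X : 𝒜) : IsRegularEpi (reflUnit P X) := by
  let F := Regular.strongEpiMonoFactorisation (reflUnit P X)
  obtain ⟨hY, hη⟩ := isReflection_reflUnit P X
  have hI : P F.I := P.prop_of_mono F.m hY
  obtain ⟨k, hk, -⟩ := hη hI F.e
  have hkm : k ≫ F.m = 𝟙 _ := by
    refine (hη hY (reflUnit P X)).unique ?_ (by simp)
    rw [← Category.assoc, hk, F.fac]
  have : IsSplitEpi F.m := ⟨⟨⟨k, hkm⟩⟩⟩
  have : IsIso F.m := isIso_of_mono_of_isSplitEpi F.m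
  have : StrongEpi (reflUnit P X) := by
    rw [← F.fac]
    exact strongEpi_comp _ _
  infer_instance

/-- Birkhoff subcategories `𝒞` and `ℬ` of `𝒜` give rise to a Birkhoff subcategory of `ℬ`. -/
instance isBirkhoff_within [Regular 𝒜] (𝒞 ℬ : ObjectProperty 𝒜) [IsBirkhoff ℬ] [IsBirkhoff 𝒞] :
    IsBirkhoff (within 𝒞 ℬ) where
  prop_of_mono {X Y} f _ hY := by
    have : Mono (ℬ.ι.map f) := inferInstance
    exact 𝒞.prop_of_mono (ℬ.ι.map f) hY
  isRightAdjoint := by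
    apply isRightAdjoint_of_isReflection
    intro X
    obtain ⟨hY, hη⟩ := isReflection_reflUnit 𝒞 X.obj
    have hB : ℬ ((reflection 𝒞).obj X.obj) :=
      IsBirkhoff.of_isRegularEpi _ (isRegularEpi_reflUnit 𝒞 X.obj) X.property
    refine ⟨⟨_, hB⟩, ObjectProperty.homMk (reflUnit 𝒞 X.obj), hY, fun Z hZ g => ?_⟩
    obtain ⟨k, hk, huniq⟩ := hη hZ g.hom
    refine ⟨ObjectProperty.homMk k, by ext; exact hk, fun m hm => ?_⟩
    ext
    exact huniq _ (congrArg (fun q => q.hom) hm)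
  of_isRegularEpi X Y f hf hX := by
    let F := Regular.strongEpiMonoFactorisation f.hom
    have hI : ℬ F.I := ℬ.prop_of_mono F.m Y.property
    let e : X ⟶ ⟨F.I, hI⟩ := ObjectProperty.homMk F.e
    let m : (⟨F.I, hI⟩ : ℬ.FullSubcategory) ⟶ Y := ObjectProperty.homMk F.m
    have hfac : e ≫ m = f := by ext; exact F.fac
    have : Mono m := ⟨fun a b h => by
      ext
      rw [← cancel_mono F.m]
      exact congrArg (fun q => q.hom) h⟩
    have : StrongEpi m := by
      have : StrongEpi (e ≫ m) := by rw [hfac]; infer_instance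
      exact strongEpi_of_strongEpi e m
    have : IsIso m := isIso_of_mono_of_strongEpi m
    have : IsIso F.m := inferInstanceAs (IsIso (ℬ.ι.map m))
    have hCI : 𝒞 F.I := IsBirkhoff.of_isRegularEpi (P := 𝒞) F.e inferInstance hX
    exact 𝒞.prop_of_iso (asIso F.m) hCI

end FullSubcategory

/-! ### Extensions, central extensions, perfect objects -/

section Central

variable {𝒜 : Type u} [Category.{v} 𝒜] (P : ObjectProperty 𝒜)

/-- A trivial extension: a regular epimorphism whose naturality square with respect to the
reflections of its domain and codomain is a pullback. -/
def IsTrivialExt {B A : 𝒜} (f : B ⟶ A) : Prop :=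
  IsRegularEpi f ∧ ∃ (B' A' : 𝒜) (ηB : B ⟶ B') (ηA : A ⟶ A') (f' : B' ⟶ A'),
    IsReflection P ηB ∧ IsReflection P ηA ∧ IsPullback f ηB ηA f'

/-- A central extension: a regular epimorphism that becomes a trivial extension after pulling back
along some regular epimorphism. -/
def IsCentralExt [HasPullbacks 𝒜] {B A : 𝒜} (f : B ⟶ A) : Prop :=
  IsRegularEpi f ∧ ∃ (C : 𝒜) (g : C ⟶ A), IsRegularEpi g ∧ IsTrivialExt P (pullback.fst g f)

/-- A universal central extension of `A`: an initial object among the central extensions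
of `A`. -/
def IsUniversalCentralExt [HasPullbacks 𝒜] {U A : 𝒜} (u : U ⟶ A) : Prop :=
  IsCentralExt P u ∧
    ∀ ⦃B : 𝒜⦄ (f : B ⟶ A), IsCentralExt P f → ∃! h : U ⟶ B, h ≫ f = u

/-- A perfect object: one whose reflection is a zero object. -/
def IsPerfect (X : 𝒜) : Prop := ∃ (Y : 𝒜) (η : X ⟶ Y), IsReflection P η ∧ IsZero Y

end Central

/-! ### Abelian objects and the universal central extension condition -/

section UCE

variable (𝒜 : Type u) [Category.{v} 𝒜]

/-- `Ab(𝒜)`: the objects that admit an internal abelian group structure. -/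
def abelianObjects [HasFiniteProducts 𝒜] : ObjectProperty 𝒜 := fun X =>
  letI : CartesianMonoidalCategory 𝒜 := CartesianMonoidalCategory.ofHasFiniteProducts
  letI : BraidedCategory 𝒜 := BraidedCategory.ofCartesianMonoidalCategory
  ∃ _ : GrpObj X, IsCommMonObj X

/-- Condition (UCE): `Ab(𝒜)`-central extensions `g : C ⟶ B` and `f : B ⟶ A` with `B` an
`Ab(𝒜)`-perfect object have an `Ab(𝒜)`-central composite. -/
def ConditionUCE [HasFiniteLimits 𝒜] : Prop :=
  ∀ ⦃C B A : 𝒜⦄ (g : C ⟶ B) (f : B ⟶ A), IsPerfect (abelianObjects 𝒜) B →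
    IsCentralExt (abelianObjects 𝒜) f → IsCentralExt (abelianObjects 𝒜) g →
    IsCentralExt (abelianObjects 𝒜) (g ≫ f)

end UCE

/-! ### Projective presentations, commutators and the Hopf formula -/

section Homology

/-- A projective presentation of `A`: a regular epimorphism `π : X ⟶ A` whose domain is
projective with respect to regular epimorphisms. -/
structure Presentation {𝒜 : Type u} [Category.{v} 𝒜] (A : 𝒜) where
  X : 𝒜
  π : X ⟶ A
  isRegularEpi : IsRegularEpi π
  projective : ∀ ⦃E Y : 𝒜⦄ (e : E ⟶ Y), IsRegularEpi e → ∀ g : X ⟶ Y, ∃ h : X ⟶ E, h ≫ e = g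

/-- Every object has a projective presentation. -/
class EnoughRegularProjectives (𝒜 : Type u) [Category.{v} 𝒜] : Prop where
  presentation : ∀ A : 𝒜, Nonempty (Presentation A)

variable {𝒜 : Type u} [Category.{v} 𝒜] [HasZeroMorphisms 𝒜] [HasFiniteLimits 𝒜]
  (P : ObjectProperty 𝒜) [P.ι.IsRightAdjoint]

/-- `[X, X]`: the kernel of the unit `η` at `X`. -/
noncomputable abbrev commObj (X : 𝒜) : 𝒜 := kernel (reflUnit P X)

/-- The inclusion `μ` of `[X, X]` in `X`. -/
noncomputable def commι (X : 𝒜) : commObj P X ⟶ X := kernel.ι (reflUnit P X)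

/-- The morphism `[f, f]`. -/
noncomputable def commMap {X Y : 𝒜} (f : X ⟶ Y) : commObj P X ⟶ commObj P Y :=
  kernel.map _ _ f ((reflection P).map f) (reflUnit_naturality P f)

lemma commMap_commι {X Y : 𝒜} (f : X ⟶ Y) : commMap P f ≫ commι P Y = commι P X ≫ f := by
  simp [commMap, commι]

variable {X A : 𝒜} (f : X ⟶ A)

/-- `[K, X]` for `K` the kernel of `f`: the kernel of `[f₀, f₀]`, where `f₀` and `f₁` are the
projections of the kernel pair of `f`. -/
noncomputable abbrev relComm : 𝒜 := kernel (commMap P (pullback.fst f f))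

/-- The morphism `[K, X] ⟶ [X, X]` induced by `[f₁, f₁]`. -/
noncomputable def relCommToComm : relComm P f ⟶ commObj P X :=
  kernel.ι (commMap P (pullback.fst f f)) ≫ commMap P (pullback.snd f f)

lemma relCommToComm_comp : relCommToComm P f ≫ commι P X ≫ f = 0 := by
  have h : commMap P (pullback.snd f f) ≫ commι P X ≫ f =
      commMap P (pullback.fst f f) ≫ commι P X ≫ f := by
    rw [← Category.assoc, commMap_commι, ← Category.assoc, commMap_commι, Category.assoc,
      Category.assoc, pullback.condition]
  rw [relCommToComm, Category.assoc, h, ← Category.assoc, kernel.condition, zero_comp]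

/-- `K ∧ [X, X]` for `K` the kernel of `f`. -/
noncomputable abbrev kerInfComm : 𝒜 := pullback (kernel.ι f) (commι P X)

/-- The morphism `[K, X] ⟶ K ∧ [X, X]`. -/
noncomputable def relCommToKerInfComm : relComm P f ⟶ kerInfComm P f :=
  pullback.lift (kernel.lift f (relCommToComm P f ≫ commι P X)
    (by rw [Category.assoc, relCommToComm_comp])) (relCommToComm P f) (by simp)

namespace Presentation

variable [HasCokernels 𝒜] {Y : 𝒜} (p : Presentation Y)

/-- `U(Y, I) = [X, X] / [K, X]`, computed from a projective presentation of `Y` with domain `X`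
and kernel `K`. -/
noncomputable abbrev U : 𝒜 := cokernel (relCommToComm P p.π)

/-- The morphism `u : U(Y, I) ⟶ Y` induced by the presentation. -/
noncomputable def u : p.U P ⟶ Y :=
  cokernel.desc (relCommToComm P p.π) (commι P p.X ≫ p.π) (relCommToComm_comp P p.π)

/-- The second homology object `H₂(Y, I) = (K ∧ [X, X]) / [K, X]`, computed from a projective
presentation of `Y` with domain `X` and kernel `K`. -/
noncomputable abbrev H₂ : 𝒜 := cokernel (relCommToKerInfComm P p.π)

end Presentation

end Homology

end CentralExt

open CentralExt

/-! Everything is reduced to commutators of generalized elements. A regular epimorphism `f : B ⟶ A`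
is central exactly when it is normal: maps into `B` that agree over `A` agree on commutators
(`isCentralExt_iff`). A perfect object is its own commutator, so a map from it into a central
extension is determined by its composite to the base (`IsNormalMor.eq_of_perfect`). For a
presentation `X ⟶ A`, the quotient `X / [K, X]` is a weakly universal normal extension containing
`U(A, I)`. If `A` is perfect, so is `U(A, I)`, hence it is universal; the kernel of `u` is `H₂`. For
the comparison, central extensions in `ℬ` are the central extensions of `𝒜` lying in `ℬ`, so
reflecting `U(B, JI)` into `ℬ` gives `U(B, J)`, up to `θ`. Put `Q = U(B, J)`. The composite `U(Q,
JI) ⟶ Q ⟶ B` is central: a normal extension with perfect domain is already central for the abelian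
objects, where (UCE) applies. Universality over `B` then identifies `U(B, JI)` with `U(Q, JI)` over
`Q`. Comparing kernels over `Q` gives `Ker η ≅ H₂(Q, JI)`, and a regular epimorphism is invertible
exactly when its kernel is zero. -/

namespace CentralExt

attribute [local simp] prod.lift_fst prod.lift_snd prod.lift_fst_assoc prod.lift_snd_assoc
  pullback.lift_fst pullback.lift_snd pullback.lift_fst_assoc pullback.lift_snd_assoc
  coequalizer.π_desc kernel.lift_ι kernel.lift_ι_assoc

/-! ### Regular epimorphisms in regular categories -/

section RegularEpi

variable {𝒜 : Type u} [Category.{v} 𝒜]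

/-- Membership in a subobject may be tested after a cover, because regular epimorphisms are strong.
-/
lemma exists_factorThru_of_mono {S' S M Y : 𝒜} (e : S' ⟶ S) [IsRegularEpi e] (m : M ⟶ Y) [Mono m]
    (l : S' ⟶ M) (k : S ⟶ Y) (h : l ≫ m = e ≫ k) : ∃ t : S ⟶ M, t ≫ m = k :=
  let sq : CommSq l e m k := ⟨h⟩
  ⟨sq.lift, sq.fac_right⟩

variable [Regular 𝒜]

lemma isRegularEpi_comp {X Y Z : 𝒜} {f : X ⟶ Y} {g : Y ⟶ Z} (hf : IsRegularEpi f)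
    (hg : IsRegularEpi g) : IsRegularEpi (f ≫ g) := by
  have : StrongEpi (f ≫ g) := strongEpi_comp f g
  infer_instance

lemma isRegularEpi_of_comp {X Y Z : 𝒜} {f : X ⟶ Y} {g : Y ⟶ Z} (h : IsRegularEpi (f ≫ g)) :
    IsRegularEpi g := by
  have : StrongEpi g := strongEpi_of_strongEpi f g
  infer_instance

lemma isRegularEpi_of_comp_eq {X Y Z : 𝒜} {f : X ⟶ Y} {g : Y ⟶ Z} {k : X ⟶ Z}
    (hk : IsRegularEpi k) (h : f ≫ g = k) : IsRegularEpi g :=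
  isRegularEpi_of_comp (f := f) (h ▸ hk)

lemma exists_cover_lift {S X Y : 𝒜} (f : X ⟶ Y) (hf : IsRegularEpi f) (k : S ⟶ Y) :
    ∃ (S' : 𝒜) (e : S' ⟶ S) (l : S' ⟶ X), IsRegularEpi e ∧ l ≫ f = e ≫ k :=
  ⟨_, pullback.snd f k, pullback.fst f k, inferInstance, pullback.condition⟩

end RegularEpi

/-! ### Kernels and regular epimorphisms in semi-abelian categories -/

section SemiAbelian

variable {𝒜 : Type u} [Category.{v} 𝒜] [HasZeroMorphisms 𝒜] [SemiAbelian 𝒜]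

/-- Morphisms on the domain of a split epimorphism are determined by their restrictions to the
kernel and to the section. -/
lemma eq_of_kernel_of_section {B A Z : 𝒜} (f : B ⟶ A) (s : A ⟶ B) (hs : s ≫ f = 𝟙 A)
    {a b : B ⟶ Z} (hk : ∀ ⦃S : 𝒜⦄ (z : S ⟶ B), z ≫ f = 0 → z ≫ a = z ≫ b)
    (hab : s ≫ a = s ≫ b) : a = b := by
  have := isIso_of_kernel_of_section f s hs (equalizer.ι a b) (equalizer.lift s hab)
    (equalizer.lift_ι _ _) (equalizer.lift (kernel.ι f) (hk _ (kernel.condition f)))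
    (equalizer.lift_ι _ _)
  rw [← cancel_epi (equalizer.ι a b), equalizer.condition]

/-- The first projection is split by the diagonal, where both sides agree; its kernel consists of
pairs `(0, z)` with `z` killed by `f`, where both sides vanish. -/
lemma kernelPair_fst_comp_eq {X Y T : 𝒜} (f : X ⟶ Y) (t : X ⟶ T)
    (h : ∀ ⦃S : 𝒜⦄ (z : S ⟶ X), z ≫ f = 0 → z ≫ t = 0) :
    pullback.fst f f ≫ t = pullback.snd f f ≫ t := by
  refine eq_of_kernel_of_section (pullback.fst f f) (pullback.lift (𝟙 _) (𝟙 _) rfl) (by simp)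
    (fun S z hz => ?_) (by simp)
  rw [reassoc_of% hz, zero_comp, ← Category.assoc, h]
  rw [Category.assoc, ← pullback.condition, reassoc_of% hz, zero_comp]

lemma mono_of_forall_eq_zero {X Y : 𝒜} (f : X ⟶ Y)
    (h : ∀ ⦃S : 𝒜⦄ (z : S ⟶ X), z ≫ f = 0 → z = 0) : Mono f := by
  have := kernelPair_fst_comp_eq f (𝟙 X) (fun S z hz => by rw [h z hz, zero_comp])
  refine ⟨fun a b hab => ?_⟩
  simpa using congrArg (pullback.lift a b hab ≫ ·) this

/-- Regular epimorphisms are normal. -/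
lemma exists_desc_of_forall_eq_zero {X Y T : 𝒜} (f : X ⟶ Y) (hf : IsRegularEpi f) (t : X ⟶ T)
    (h : ∀ ⦃S : 𝒜⦄ (z : S ⟶ X), z ≫ f = 0 → z ≫ t = 0) : ∃ s : Y ⟶ T, f ≫ s = t := by
  have := kernelPair_fst_comp_eq f t h
  refine ⟨IsRegularEpi.desc f t ?_, IsRegularEpi.fac _ _ _⟩
  simpa using congrArg (pullback.lift _ _ (IsRegularEpi.w f) ≫ ·) this

/-- The direct image of a normal subobject along a regular epimorphism is normal. -/
lemma exists_quotient_by_directImage {X Y H : 𝒜} (f : X ⟶ Y) (hf : IsRegularEpi f) (h : X ⟶ H) :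
    ∃ (Z : 𝒜) (g : Y ⟶ Z), IsRegularEpi g ∧
      (∀ ⦃S : 𝒜⦄ (z : S ⟶ X), z ≫ h = 0 → z ≫ f ≫ g = 0) ∧
      ∀ ⦃S : 𝒜⦄ (z : S ⟶ Y), z ≫ g = 0 →
        ∃ (S' : 𝒜) (e : S' ⟶ S) (l : S' ⟶ X), IsRegularEpi e ∧ l ≫ h = 0 ∧ l ≫ f = e ≫ z := by
  -- The image under `f` of the kernel pair of `h` is a reflexive relation on `Y`, hence a kernel
  -- pair; `g` is its quotient.
  let F := Regular.strongEpiMonoFactorisation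
    (prod.lift (pullback.fst h h ≫ f) (pullback.snd h h ≫ f))
  let p₁ : F.I ⟶ Y := F.m ≫ prod.fst
  let p₂ : F.I ⟶ Y := F.m ≫ prod.snd
  have he₁ : F.e ≫ p₁ = pullback.fst h h ≫ f := by
    simp only [p₁, ← Category.assoc, F.fac]; simp
  have he₂ : F.e ≫ p₂ = pullback.snd h h ≫ f := by
    simp only [p₂, ← Category.assoc, F.fac]; simp
  have hFe : IsRegularEpi F.e := by dsimp only [F]; infer_instance
  have hmono : JointlyMono₂ p₁ p₂ := ⟨fun Z a b h h' => by
    rw [← cancel_mono F.m]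
    apply prod.hom_ext
    · simpa [p₁] using h
    · simpa [p₂] using h'⟩
  obtain ⟨r, hr⟩ := exists_factorThru_of_mono f F.m
    (pullback.lift (𝟙 _) (𝟙 _) rfl ≫ F.e) (prod.lift (𝟙 Y) (𝟙 Y)) (by
      rw [Category.assoc, F.fac]
      apply prod.hom_ext <;> simp)
  have hrel := isEquivalenceRelation_of_reflexive hmono r
    (by simp only [p₁, ← Category.assoc, hr]; simp) (by simp only [p₂, ← Category.assoc, hr]; simp)
  obtain ⟨Z₀, g₀, hk⟩ := SemiAbelian.isKernelPair_of_isEquivalenceRelation p₁ p₂ hrel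
  let G := Regular.strongEpiMonoFactorisation g₀
  have hG : ∀ {S : 𝒜} (z : S ⟶ Y), z ≫ G.e = 0 ↔ z ≫ g₀ = 0 := fun z => by
    rw [← cancel_mono G.m, Category.assoc, G.fac, zero_comp]
  refine ⟨G.I, G.e, by dsimp only [G]; infer_instance, fun S z hz => ?_, fun S z hz => ?_⟩
  · have h1 := pullback.lift (0 : S ⟶ X) z (by simp [hz]) ≫= (F.e ≫= hk.w)
    rw [reassoc_of% he₁, reassoc_of% he₂] at h1
    rw [← Category.assoc, hG, Category.assoc]
    simpa using h1.symm
  · rw [hG] at hz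
    obtain ⟨S', e, l', he, hl'⟩ := exists_cover_lift F.e hFe (hk.lift (0 : S ⟶ Y) z (by simp [hz]))
    have h1 : l' ≫ pullback.fst h h ≫ f = 0 := by
      have := hl' =≫ p₁
      simpa [he₁] using this
    have h2 : l' ≫ pullback.snd h h ≫ f = e ≫ z := by
      have := hl' =≫ p₂
      simpa [he₂] using this
    -- So far `z` is, after a cover, `f x'` for a pair `(x, x')` with `h x = h x'` and only `f x =
    -- 0`, not `x = 0`. To place `f x'` in the image `N` of `Ker h`, note that `a : (x, x') ↦ x` is
    -- split by the diagonal. On the diagonal `φ` vanishes, and on `Ker a` it takes values in `N`;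
    -- hence it does so everywhere.
    let j := kernel.ι (pullback.fst h h ≫ f)
    have hj : j ≫ pullback.fst h h ≫ f = 0 := kernel.condition _
    let φ := j ≫ pullback.snd h h ≫ f
    let N := Regular.strongEpiMonoFactorisation (kernel.ι h ≫ f)
    have hNe : IsRegularEpi N.e := by dsimp only [N]; infer_instance
    let a := kernel.lift f (j ≫ pullback.fst h h) (by rw [Category.assoc, hj])
    let s := kernel.lift (pullback.fst h h ≫ f)
      (pullback.lift (kernel.ι f) (kernel.ι f) rfl) (by simp)
    have hs : s ≫ a = 𝟙 _ := by
      rw [← cancel_mono (kernel.ι f)]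
      simp [s, a, j]
    have hz' : kernel.ι a ≫ j ≫ pullback.fst h h = 0 := by
      have := kernel.condition a =≫ kernel.ι f
      rwa [Category.assoc, kernel.lift_ι, zero_comp] at this
    let t := kernel.lift h (kernel.ι a ≫ j ≫ pullback.snd h h) (by
      rw [Category.assoc, Category.assoc, ← pullback.condition, reassoc_of% hz', zero_comp])
    have : IsIso (pullback.fst φ N.m) := by
      refine isIso_of_kernel_of_section a s hs _ (pullback.lift s 0 ?_)
        (pullback.lift_fst _ _ _)
        (pullback.lift (kernel.ι a) (t ≫ N.e) ?_) (pullback.lift_fst _ _ _)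
      · simp [s, φ, j]
      · rw [Category.assoc, N.fac]
        simp [t, φ]
    let l'' : S' ⟶ N.I :=
      kernel.lift _ l' h1 ≫ inv (pullback.fst φ N.m) ≫ pullback.snd φ N.m
    have hl'' : l'' ≫ N.m = e ≫ z := by
      simp only [l'', Category.assoc, ← pullback.condition, IsIso.inv_hom_id_assoc]
      simp [φ, j, h2]
    obtain ⟨S'', e', l, he', hl⟩ := exists_cover_lift N.e hNe l''
    refine ⟨S'', e' ≫ e, l ≫ kernel.ι h, isRegularEpi_comp he' he, by simp, ?_⟩
    rw [Category.assoc, ← N.fac, reassoc_of% hl, hl'', Category.assoc]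

/-- A square of regular epimorphisms is a pullback when it induces a bijection on kernels. -/
lemma isPullback_of_existsUnique {X Y X' Y' : 𝒜} {f : X ⟶ Y} {a : X ⟶ X'} {b : Y ⟶ Y'}
    {f' : X' ⟶ Y'} (w : f ≫ b = a ≫ f') (ha : IsRegularEpi a) (hb : IsRegularEpi b)
    (h : ∀ ⦃S : 𝒜⦄ (y : S ⟶ Y), y ≫ b = 0 → ∃! x : S ⟶ X, x ≫ a = 0 ∧ x ≫ f = y) :
    IsPullback f a b f' := by
  let c : X ⟶ pullback b f' := pullback.lift f a w
  have hc : IsIso c := by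
    refine SemiAbelian.shortFive a (pullback.snd b f') c (𝟙 _) (by simp [c]) ha inferInstance
      inferInstance ?_
    obtain ⟨x, ⟨hxa, hxf⟩, -⟩ := h (kernel.ι (pullback.snd b f') ≫ pullback.fst b f')
      (by rw [Category.assoc, pullback.condition, kernel.condition_assoc, zero_comp])
    refine ⟨kernel.lift a x hxa, ?_, ?_⟩
    · rw [← cancel_mono (kernel.ι a)]
      refine (h (kernel.ι a ≫ f) (by rw [Category.assoc, w, kernel.condition_assoc,
        zero_comp])).unique ⟨?_, ?_⟩ ⟨?_, ?_⟩
      · simp [hxa]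
      · simp [hxf, c]
      · simp
      · simp
    · rw [← cancel_mono (kernel.ι _)]
      apply pullback.hom_ext
      · simp [c, hxf]
      · simp [c, hxa]
  exact IsPullback.of_iso_pullback ⟨w⟩ (asIso c) (by simp [c]) (by simp [c])

end SemiAbelian

/-! ### Commutators and normal morphisms in terms of generalized elements -/

section InComm

variable {𝒜 : Type u} [Category.{v} 𝒜] [HasZeroMorphisms 𝒜]

/-- The generalized element `k` of `T` lies in the commutator `[T, T]`: it is killed by all
morphisms from `T` to objects satisfying `P`. -/
def InComm (P : ObjectProperty 𝒜) {S T : 𝒜} (k : S ⟶ T) : Prop :=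
  ∀ ⦃Z : 𝒜⦄, P Z → ∀ g : T ⟶ Z, k ≫ g = 0

/-- Any two morphisms that become equal after composition with `f` agree on commutators. -/
def IsNormalMor (P : ObjectProperty 𝒜) {B A : 𝒜} (f : B ⟶ A) : Prop :=
  ∀ ⦃S T : 𝒜⦄ (x y : T ⟶ B) (k : S ⟶ T), x ≫ f = y ≫ f → InComm P k → k ≫ x = k ≫ y

variable {P Q : ObjectProperty 𝒜}

lemma InComm.comp {S T U : 𝒜} {k : S ⟶ T} (hk : InComm P k) (f : T ⟶ U) : InComm P (k ≫ f) :=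
  fun Z hZ g => by rw [Category.assoc, hk hZ]

lemma InComm.precomp {R S T : 𝒜} {k : S ⟶ T} (hk : InComm P k) (a : R ⟶ S) : InComm P (a ≫ k) :=
  fun Z hZ g => by rw [Category.assoc, hk hZ, comp_zero]

lemma InComm.anti (hPQ : P ≤ Q) {S T : 𝒜} {k : S ⟶ T} (hk : InComm Q k) : InComm P k :=
  fun Z hZ g => hk (hPQ Z hZ) g

lemma InComm.of_epi {R S T : 𝒜} (e : R ⟶ S) [Epi e] {k : S ⟶ T} (hk : InComm P (e ≫ k)) :
    InComm P k := fun Z hZ g => by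
  rw [← cancel_epi e, ← Category.assoc, hk hZ, comp_zero]

lemma IsNormalMor.of_comp {C B A : 𝒜} {m : C ⟶ B} {f : B ⟶ A} (h : IsNormalMor P (m ≫ f)) :
    IsNormalMor P m := fun S T x y k hxy hk =>
  h x y k (by rw [← Category.assoc, hxy, Category.assoc]) hk

lemma IsNormalMor.comp_mono {C B A : 𝒜} {f : B ⟶ A} (h : IsNormalMor P f) (m : C ⟶ B) [Mono m] :
    IsNormalMor P (m ≫ f) := fun S T x y k hxy hk => by
  rw [← cancel_mono m, Category.assoc, Category.assoc]
  exact h (x ≫ m) (y ≫ m) k (by simpa using hxy) hk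

/-- Two morphisms out of a perfect object that agree over the codomain of a normal morphism
are equal. -/
lemma IsNormalMor.eq_of_perfect {U B A : 𝒜} {f : B ⟶ A} (h : IsNormalMor P f)
    (hU : InComm P (𝟙 U)) {x y : U ⟶ B} (hxy : x ≫ f = y ≫ f) : x = y := by
  simpa using h x y (𝟙 U) hxy hU

lemma IsPerfect.inComm {X : 𝒜} (h : IsPerfect P X) : InComm P (𝟙 X) := by
  obtain ⟨Y, η, ⟨-, hη⟩, hY⟩ := h
  intro Z hZ g
  obtain ⟨k, rfl, -⟩ := hη hZ g
  rw [hY.eq_zero_of_tgt η, zero_comp, comp_zero]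

lemma isReflection_zero {X : 𝒜} (h : InComm P (𝟙 X)) {Y : 𝒜} (hY : IsZero Y) (hPY : P Y) :
    IsReflection P (0 : X ⟶ Y) :=
  ⟨hPY, fun Z hZ g => ⟨0, by simpa using (h hZ g).symm, fun y _ => hY.eq_zero_of_src y⟩⟩

/-- Maps into the pullback are compared componentwise: over `A` they agree, and commutators die in
the reflection of `B`. Allowing `P ≤ Q` serves the passage from abelian objects to `𝒞`. -/
lemma IsTrivialExt.isNormalMor (hPQ : P ≤ Q) {B A : 𝒜} {f : B ⟶ A} (h : IsTrivialExt P f) :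
    IsNormalMor Q f := by
  obtain ⟨-, B', A', ηB, ηA, f', hB, hA, sq⟩ := h
  intro S T x y k hxy hk
  apply sq.hom_ext
  · rw [Category.assoc, Category.assoc, hxy]
  · rw [Category.assoc, Category.assoc, hk (hPQ _ hB.1), hk (hPQ _ hB.1)]

variable (P)

lemma IsBirkhoff.prop_of_isZero [IsBirkhoff P] {Y : 𝒜} (hY : IsZero Y) : P Y := by
  have : Mono (0 : Y ⟶ (reflection P).obj Y) := ⟨fun a b _ => hY.eq_of_tgt a b⟩
  exact P.prop_of_mono (0 : Y ⟶ (reflection P).obj Y) (isReflection_reflUnit P Y).1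

end InComm

section Reflection

variable {𝒜 : Type u} [Category.{v} 𝒜] [HasZeroMorphisms 𝒜] {P : ObjectProperty 𝒜}
  [P.ι.IsRightAdjoint]

lemma inComm_iff {S T : 𝒜} {k : S ⟶ T} : InComm P k ↔ k ≫ reflUnit P T = 0 := by
  refine ⟨fun h => h (isReflection_reflUnit P T).1 _, fun h Z hZ g => ?_⟩
  obtain ⟨l, rfl, -⟩ := (isReflection_reflUnit P T).2 hZ g
  rw [reassoc_of% h, zero_comp]

variable [HasFiniteLimits 𝒜]

instance (X : 𝒜) : Mono (commι P X) := inferInstanceAs (Mono (kernel.ι _))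

lemma inComm_commι (X : 𝒜) : InComm P (commι P X) := inComm_iff.2 (kernel.condition _)

lemma InComm.exists_factorThru {S T : 𝒜} {k : S ⟶ T} (hk : InComm P k) :
    ∃ l : S ⟶ commObj P T, l ≫ commι P T = k :=
  ⟨kernel.lift _ k (inComm_iff.1 hk), kernel.lift_ι _ _ _⟩

end Reflection

/-! ### Central extensions as normal regular epimorphisms -/

section Central

variable {𝒜 : Type u} [Category.{v} 𝒜] [HasZeroMorphisms 𝒜] [SemiAbelian 𝒜]
  {P Q : ObjectProperty 𝒜}

/-- Commutators are preserved by regular epimorphisms. -/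
lemma InComm.exists_cover_lift [IsBirkhoff P] {X Y S : 𝒜} {f : X ⟶ Y} (hf : IsRegularEpi f)
    {k : S ⟶ Y} (hk : InComm P k) :
    ∃ (S' : 𝒜) (e : S' ⟶ S) (l : S' ⟶ X), IsRegularEpi e ∧ InComm P l ∧ l ≫ f = e ≫ k := by
  -- `Z` is the quotient of `Y` by the image of `[X, X]`. It is also a regular quotient of the
  -- reflection of `X`, hence satisfies `P`, so `k` dies in it.
  obtain ⟨Z, g, hg, h₁, h₂⟩ := exists_quotient_by_directImage f hf (reflUnit P X)
  obtain ⟨s, hs⟩ := exists_desc_of_forall_eq_zero (reflUnit P X) (isRegularEpi_reflUnit P X)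
    (f ≫ g) h₁
  have hZ : P Z := IsBirkhoff.of_isRegularEpi s
    (isRegularEpi_of_comp_eq (isRegularEpi_comp hf hg) hs) (isReflection_reflUnit P X).1
  obtain ⟨S', e, l, he, hl, hle⟩ := h₂ k (hk hZ g)
  exact ⟨S', e, l, he, inComm_iff.2 hl, hle⟩

/-- Pulling `g` back to `T` gives a cover on which `x` and `y` lift to the pulled-back extension;
`k` lifts to a commutator of that cover. -/
lemma IsNormalMor.of_pullback [IsBirkhoff P] {C B A : 𝒜} {g : C ⟶ A} {f : B ⟶ A}
    (hg : IsRegularEpi g) (h : IsNormalMor P (pullback.fst g f)) : IsNormalMor P f := by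
  intro S T x y k hxy hk
  have he : IsRegularEpi (pullback.snd g (x ≫ f)) := inferInstance
  obtain ⟨S', e, k', he', hk', hkk'⟩ := hk.exists_cover_lift he
  have hx := h (pullback.lift (pullback.fst g (x ≫ f)) (pullback.snd g (x ≫ f) ≫ x)
    (by rw [pullback.condition, Category.assoc]))
    (pullback.lift (pullback.fst g (x ≫ f)) (pullback.snd g (x ≫ f) ≫ y)
    (by rw [Category.assoc, ← hxy, pullback.condition])) k' (by simp) hk'
  rw [← cancel_epi e, ← reassoc_of% hkk', ← reassoc_of% hkk']
  simpa using hx =≫ pullback.snd g f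

lemma IsCentralExt.isNormalMor [IsBirkhoff Q] (hPQ : P ≤ Q) {B A : 𝒜} {f : B ⟶ A}
    (h : IsCentralExt P f) : IsNormalMor Q f := by
  obtain ⟨-, C, g, hg, hgf⟩ := h
  exact .of_pullback hg (hgf.isNormalMor hPQ)

/-- The extension splits itself: by normality the commutators of its kernel pair lie on the
diagonal, so the first projection is bijective on commutators and thus trivial. -/
lemma IsNormalMor.isCentralExt [IsBirkhoff P] {B A : 𝒜} {f : B ⟶ A} (hf : IsRegularEpi f)
    (h : IsNormalMor P f) : IsCentralExt P f := by
  refine ⟨hf, B, f, hf, inferInstance, _, _, reflUnit P _, reflUnit P _,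
    (reflection P).map (pullback.fst f f), isReflection_reflUnit P _, isReflection_reflUnit P _,
    isPullback_of_existsUnique (reflUnit_naturality P _).symm (isRegularEpi_reflUnit P _)
      (isRegularEpi_reflUnit P _) fun S y hy => ?_⟩
  rw [← inComm_iff] at hy
  refine ⟨y ≫ pullback.lift (𝟙 _) (𝟙 _) rfl, ⟨inComm_iff.1 (hy.comp _), by simp⟩, ?_⟩
  rintro x ⟨hx, rfl⟩
  have := h _ _ x pullback.condition (inComm_iff.2 hx)
  apply pullback.hom_ext
  · simp
  · simp [this]

lemma isCentralExt_iff [IsBirkhoff P] {B A : 𝒜} {f : B ⟶ A} :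
    IsCentralExt P f ↔ IsRegularEpi f ∧ IsNormalMor P f :=
  ⟨fun h => ⟨h.1, h.isNormalMor le_rfl⟩, fun h => h.2.isCentralExt h.1⟩

/-- Normality descends to the second factor of a composite with a regular epimorphism. -/
lemma IsNormalMor.of_regularEpi_comp [IsBirkhoff P] {C B A : 𝒜} {g : C ⟶ B} {f : B ⟶ A}
    (hg : IsRegularEpi g) (h : IsNormalMor P (g ≫ f)) : IsNormalMor P f := by
  intro S T x y k hxy hk
  -- This is a cover of `T` on which both `x` and `y` lift along `g`.
  have he : IsRegularEpi (pullback.snd g (pullback.snd g x ≫ y) ≫ pullback.snd g x) :=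
    isRegularEpi_comp inferInstance inferInstance
  obtain ⟨S', e, k', he', hk', hkk'⟩ := hk.exists_cover_lift he
  have hx := h (pullback.snd g (pullback.snd g x ≫ y) ≫ pullback.fst g x)
    (pullback.fst g (pullback.snd g x ≫ y)) k' (by
      rw [pullback.condition_assoc, Category.assoc, pullback.condition_assoc]
      simp [hxy]) hk' =≫ g
  simp only [Category.assoc, pullback.condition] at hx
  rw [← cancel_epi e, ← reassoc_of% hkk', ← reassoc_of% hkk', hx]

end Central

/-! ### The universal central extension of a perfect object -/

section Presentation

variable {𝒜 : Type u} [Category.{v} 𝒜] [HasZeroMorphisms 𝒜] [SemiAbelian 𝒜]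
  (P : ObjectProperty 𝒜) [IsBirkhoff P]

section

variable {X A : 𝒜} (f : X ⟶ A)

lemma relCommToComm_commι : relCommToComm P f ≫ commι P X =
    (kernel.ι (commMap P (pullback.fst f f)) ≫ commι P _) ≫ pullback.snd f f := by
  rw [relCommToComm, Category.assoc, commMap_commι, Category.assoc]

lemma kernel_commMap_fst :
    (kernel.ι (commMap P (pullback.fst f f)) ≫ commι P _) ≫ pullback.fst f f = 0 := by
  rw [Category.assoc, ← commMap_commι, kernel.condition_assoc, zero_comp]

/-- An element of `[K, X]` is a pair `(0, k)` in the kernel pair, so it is determined by `k`. -/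
instance : Mono (relCommToComm P f) := by
  refine ⟨fun a b hab => ?_⟩
  rw [← cancel_mono (kernel.ι (commMap P (pullback.fst f f)) ≫ commι P _)]
  apply pullback.hom_ext
  · rw [Category.assoc a, Category.assoc b, kernel_commMap_fst, comp_zero, comp_zero]
  · rw [Category.assoc a, Category.assoc b, ← relCommToComm_commι, reassoc_of% hab]

variable {P f} in
lemma InComm.exists_factorThru_relComm {S : 𝒜} {z : S ⟶ pullback f f} (hz : InComm P z)
    (h : z ≫ pullback.fst f f = 0) :
    ∃ t : S ⟶ relComm P f, t ≫ relCommToComm P f ≫ commι P X = z ≫ pullback.snd f f := by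
  obtain ⟨l, rfl⟩ := hz.exists_factorThru
  refine ⟨kernel.lift _ l ?_, ?_⟩
  · rw [← cancel_mono (commι P X), Category.assoc, commMap_commι, ← Category.assoc, h, zero_comp]
  · simp [relCommToComm_commι]

/-- The subobject `[K, X]` vanishes in every normal extension under `X`. -/
lemma relCommToComm_comp_eq_zero {E : 𝒜} {g : E ⟶ A} (hg : IsNormalMor P g) {φ : X ⟶ E}
    (hφ : φ ≫ g = f) : relCommToComm P f ≫ commι P X ≫ φ = 0 := by
  rw [← Category.assoc, relCommToComm_commι, Category.assoc, ← hg (pullback.fst f f ≫ φ)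
    (pullback.snd f f ≫ φ) _ (by simp [hφ, pullback.condition]) ((inComm_commι _).precomp _),
    ← Category.assoc, kernel_commMap_fst, zero_comp]

/-- The centralization `X / [K, X] ⟶ A` of a regular epimorphism `f : X ⟶ A`. -/
lemma exists_centralization :
    ∃ (V : 𝒜) (h : X ⟶ V) (ν : V ⟶ A), IsRegularEpi h ∧ h ≫ ν = f ∧ IsNormalMor P ν ∧
      relCommToComm P f ≫ commι P X ≫ h = 0 ∧
      ∀ ⦃S : 𝒜⦄ (z : S ⟶ X), z ≫ h = 0 →
        ∃ t : S ⟶ relComm P f, t ≫ relCommToComm P f ≫ commι P X = z := by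
  let δ : X ⟶ pullback f f := pullback.lift (𝟙 X) (𝟙 X) rfl
  -- The kernel of this pair of maps consists of the commutators `(0, k)` of the kernel pair; its
  -- image under the second projection is `[K, X]`, so `V = X / [K, X]`.
  obtain ⟨V, h, hh, h₁, h₂⟩ := exists_quotient_by_directImage (pullback.snd f f)
    (isRegularEpi_of_section _ δ (by simp [δ]))
    (prod.lift (reflUnit P (pullback f f)) (pullback.fst f f))
  have h₂' : ∀ ⦃S : 𝒜⦄ (z : S ⟶ X), z ≫ h = 0 →
      ∃ t : S ⟶ relComm P f, t ≫ relCommToComm P f ≫ commι P X = z := fun S z hz => by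
    obtain ⟨S', e, l, he, hl, hle⟩ := h₂ z hz
    obtain ⟨t, ht⟩ := InComm.exists_factorThru_relComm (z := l)
      (inComm_iff.2 (by simpa using hl =≫ prod.fst)) (by simpa using hl =≫ prod.snd)
    exact exists_factorThru_of_mono e _ t z (ht.trans hle)
  have hj : relCommToComm P f ≫ commι P X ≫ h = 0 := by
    rw [← Category.assoc, relCommToComm_commι, Category.assoc]
    apply h₁
    apply prod.hom_ext
    · simpa using inComm_iff.1 ((inComm_commι (P := P) (pullback f f)).precomp _)
    · simpa using kernel_commMap_fst P f
  obtain ⟨ν, hν⟩ := exists_desc_of_forall_eq_zero h hh f fun S z hz => by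
    obtain ⟨t, rfl⟩ := h₂' z hz
    simp [relCommToComm_comp]
  refine ⟨V, h, ν, hh, hν, ?_, hj, h₂'⟩
  -- On commutators the first projection is split by the diagonal, with kernel `[K, X]`, which `h`
  -- annihilates.
  have key : commι P (pullback f f) ≫ pullback.fst f f ≫ h =
      commι P (pullback f f) ≫ pullback.snd f f ≫ h := by
    have hδ : commMap P δ ≫ commMap P (pullback.fst f f) = 𝟙 _ := by
      rw [← cancel_mono (commι P X), Category.assoc, commMap_commι, ← Category.assoc,
        commMap_commι]
      simp [δ]
    refine eq_of_kernel_of_section _ (commMap P δ) hδ (fun S z hz => ?_) ?_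
    · have hz' : (z ≫ commι P (pullback f f)) ≫ pullback.fst f f = 0 := by
        rw [Category.assoc, ← commMap_commι, reassoc_of% hz, zero_comp]
      obtain ⟨t, ht⟩ := InComm.exists_factorThru_relComm ((inComm_commι _).precomp z) hz'
      simp only [Category.assoc] at hz' ht
      rw [reassoc_of% hz', zero_comp, ← reassoc_of% ht, hj, comp_zero]
    · have hδ' := commMap_commι P δ
      rw [reassoc_of% hδ', reassoc_of% hδ']
      simp [δ]
  intro S T x y k hxy hk
  -- Over a cover of `T`, `x` and `y` lift to `X` and form a map `m` into the kernel pair of `f`,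
  -- where `key` applies.
  let a := pullback.snd h x
  let b := pullback.snd h (a ≫ y)
  obtain ⟨S', e, k', he, hk', hkk'⟩ := hk.exists_cover_lift (f := b ≫ a)
    (isRegularEpi_comp inferInstance inferInstance)
  have hx : pullback.fst h x ≫ h = a ≫ x := pullback.condition
  have hy : pullback.fst h (a ≫ y) ≫ h = b ≫ a ≫ y := pullback.condition
  let m : pullback h (a ≫ y) ⟶ pullback f f :=
    pullback.lift (b ≫ pullback.fst h x) (pullback.fst h (a ≫ y)) (by
      simp only [← hν, Category.assoc, reassoc_of% hx, reassoc_of% hy, hxy])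
  obtain ⟨l, hl⟩ := (hk'.comp m).exists_factorThru
  have := l ≫= key
  rw [reassoc_of% hl, reassoc_of% hl] at this
  simp only [m, pullback.lift_fst_assoc, pullback.lift_snd_assoc, Category.assoc, hx, hy] at this
  rw [← cancel_epi e, ← reassoc_of% hkk', ← reassoc_of% hkk', this]

end

namespace Presentation

variable {A : 𝒜} (p : Presentation A)

/-- The morphism `[X, X] ⟶ U(A, I)`. -/
noncomputable abbrev πU : commObj P p.X ⟶ p.U P := cokernel.π (relCommToComm P p.π)

lemma πU_u : p.πU P ≫ p.u P = commι P p.X ≫ p.π := cokernel.π_desc _ _ _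

lemma isRegularEpi_πU : IsRegularEpi (p.πU P) :=
  inferInstanceAs (IsRegularEpi (coequalizer.π _ _))

/-- `U(A, I)` is contained in the commutator of a weakly universal normal extension. -/
lemma exists_mono_weaklyUniversal :
    ∃ (V : 𝒜) (w : p.U P ⟶ V) (ν : V ⟶ A), Mono w ∧ InComm P w ∧ w ≫ ν = p.u P ∧
      IsNormalMor P ν ∧
      (∀ ⦃E : 𝒜⦄ (g : E ⟶ A), IsRegularEpi g → IsNormalMor P g → ∃ ψ : V ⟶ E, ψ ≫ g = ν) ∧
      ∀ ⦃S : 𝒜⦄ (z : S ⟶ commObj P p.X), z ≫ p.πU P = 0 →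
        ∃ t : S ⟶ relComm P p.π, t ≫ relCommToComm P p.π = z := by
  obtain ⟨V, h, ν, hh, hν, hνn, hj, hker⟩ := exists_centralization P p.π
  let w : p.U P ⟶ V := cokernel.desc _ (commι P p.X ≫ h) hj
  have hw : p.πU P ≫ w = commι P p.X ≫ h := cokernel.π_desc _ _ _
  have hπ := p.isRegularEpi_πU P
  have hker' : ∀ ⦃S : 𝒜⦄ (z : S ⟶ commObj P p.X), z ≫ p.πU P ≫ w = 0 →
      ∃ t : S ⟶ relComm P p.π, t ≫ relCommToComm P p.π = z := fun S z hz => by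
    obtain ⟨t, ht⟩ := hker (z ≫ commι P p.X) (by rw [Category.assoc, ← hw, hz])
    exact ⟨t, by rw [← cancel_mono (commι P p.X), Category.assoc, ht]⟩
  refine ⟨V, w, ν, mono_of_forall_eq_zero w fun S z hz => ?_, ?_, ?_, hνn, fun E g hg hgn => ?_,
    fun S z hz => hker' z (by rw [reassoc_of% hz, zero_comp])⟩
  · obtain ⟨S', e, l, he, hl⟩ := exists_cover_lift (p.πU P) hπ z
    obtain ⟨t, rfl⟩ := hker' l (by rw [reassoc_of% hl, hz, comp_zero])
    rw [← cancel_epi e, ← hl, Category.assoc, cokernel.condition, comp_zero, comp_zero]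
  · apply InComm.of_epi (p.πU P)
    rw [hw]
    exact (inComm_commι _).comp h
  · rw [← cancel_epi (p.πU P), reassoc_of% hw, hν, πU_u]
  -- Projectivity gives a map to `E` over `A`; it annihilates `[K, X]` since `g` is normal, so it
  -- descends to `V`.
  · obtain ⟨φ, hφ⟩ := p.projective g hg p.π
    obtain ⟨ψ, hψ⟩ := exists_desc_of_forall_eq_zero h hh φ fun S z hz => by
      obtain ⟨t, rfl⟩ := hker z hz
      simp only [Category.assoc, relCommToComm_comp_eq_zero P p.π hgn hφ, comp_zero]
    exact ⟨ψ, by rw [← cancel_epi h, reassoc_of% hψ, hφ, hν]⟩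

lemma isNormalMor_u : IsNormalMor P (p.u P) := by
  obtain ⟨V, w, ν, hw, -, hwν, hν, -⟩ := p.exists_mono_weaklyUniversal P
  rw [← hwν]
  exact hν.comp_mono w

variable {P}

lemma isRegularEpi_commι_comp {X Y : 𝒜} {f : X ⟶ Y} (hf : IsRegularEpi f)
    (hY : InComm P (𝟙 Y)) : IsRegularEpi (commι P X ≫ f) := by
  obtain ⟨S, e, l, he, hl, hle⟩ := hY.exists_cover_lift hf
  obtain ⟨t, rfl⟩ := hl.exists_factorThru
  exact isRegularEpi_of_comp_eq (f := t) he (by simpa using hle)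

lemma isRegularEpi_u (hA : InComm P (𝟙 A)) : IsRegularEpi (p.u P) :=
  isRegularEpi_of_comp_eq (isRegularEpi_commι_comp p.isRegularEpi hA) (p.πU_u P)

/-- `[U, U] ⟶ A` is again a normal extension, so weak universality gives `ψ : V ⟶ [U, U]` over `A`.
Followed by the inclusion into `V`, it is an endomorphism of `V` over `A`, which fixes the
commutators of `V`, in particular `U`. Hence the identity of `U` factors through `[U, U]`. -/
lemma inComm_U (hA : InComm P (𝟙 A)) : InComm P (𝟙 (p.U P)) := by
  obtain ⟨V, w, ν, hw, hwc, hwν, hν, huniv, -⟩ := p.exists_mono_weaklyUniversal P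
  obtain ⟨ψ, hψ⟩ := huniv (commι P (p.U P) ≫ p.u P)
    (isRegularEpi_commι_comp (p.isRegularEpi_u hA) hA) ((p.isNormalMor_u P).comp_mono _)
  have h := hν (ψ ≫ commι P (p.U P) ≫ w) (𝟙 V) w (by simp [hwν, hψ]) hwc
  have h' : (w ≫ ψ) ≫ commι P (p.U P) = 𝟙 _ := by
    rw [← cancel_mono w]
    simpa using h
  rw [← h']
  exact (inComm_commι _).precomp _

/-- The universal central extension of a perfect object. -/
theorem isUniversalCentralExt_u (hA : InComm P (𝟙 A)) : IsUniversalCentralExt P (p.u P) := by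
  refine ⟨(p.isNormalMor_u P).isCentralExt (p.isRegularEpi_u hA), fun B f hf => ?_⟩
  obtain ⟨hfr, hfn⟩ := isCentralExt_iff.1 hf
  obtain ⟨V, w, ν, -, -, hwν, -, huniv, -⟩ := p.exists_mono_weaklyUniversal P
  obtain ⟨ψ, hψ⟩ := huniv f hfr hfn
  exact ⟨w ≫ ψ, by simp [hψ, hwν], fun y hy =>
    hfn.eq_of_perfect (p.inComm_U hA) (by simp [hψ, hwν, hy])⟩

variable (P)

/-- The Hopf formula: `H₂(A, I)` is the kernel of `u : U(A, I) ⟶ A`. -/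
lemma nonempty_H₂_iso_kernel : Nonempty (p.H₂ P ≅ kernel (p.u P)) := by
  obtain ⟨-, -, -, -, -, -, -, -, hker⟩ := p.exists_mono_weaklyUniversal P
  have hπ := p.isRegularEpi_πU P
  have hπu := p.πU_u P
  let a : kerInfComm P p.π ⟶ commObj P p.X := pullback.snd _ _
  have ha : a ≫ commι P p.X = pullback.fst _ _ ≫ kernel.ι p.π := pullback.condition.symm
  have : Mono a := inferInstance
  have hra : relCommToKerInfComm P p.π ≫ a = relCommToComm P p.π := pullback.lift_snd _ _ _
  let b : kerInfComm P p.π ⟶ kernel (p.u P) := kernel.lift _ (a ≫ p.πU P) (by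
    rw [Category.assoc, hπu, reassoc_of% ha, kernel.condition, comp_zero])
  have hb : b ≫ kernel.ι (p.u P) = a ≫ p.πU P := kernel.lift_ι _ _ _
  have hbr : IsRegularEpi b := by
    obtain ⟨S, e, l, he, hl⟩ := exists_cover_lift (p.πU P) hπ (kernel.ι (p.u P))
    refine isRegularEpi_of_comp_eq (f := pullback.lift (kernel.lift p.π (l ≫ commι P p.X) ?_) l
      (kernel.lift_ι _ _ _)) he ?_
    · rw [Category.assoc, ← hπu, reassoc_of% hl, kernel.condition, comp_zero]
    · rw [← cancel_mono (kernel.ι (p.u P)), Category.assoc, hb]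
      simp [a, hl]
  let i : p.H₂ P ⟶ kernel (p.u P) := cokernel.desc _ b (by
    rw [← cancel_mono (kernel.ι (p.u P)), Category.assoc, hb, reassoc_of% hra,
      cokernel.condition, zero_comp])
  have hi : cokernel.π _ ≫ i = b := cokernel.π_desc _ _ _
  have hc : IsRegularEpi (cokernel.π (relCommToKerInfComm P p.π)) :=
    inferInstanceAs (IsRegularEpi (coequalizer.π _ _))
  have : IsRegularEpi i := isRegularEpi_of_comp_eq hbr hi
  -- An element of `K ∧ [X, X]` killed in `U` comes from `[K, X]`.
  have : Mono i := mono_of_forall_eq_zero i fun S z hz => by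
    obtain ⟨S', e, l, he, hl⟩ := exists_cover_lift _ hc z
    have hlb : (l ≫ a) ≫ p.πU P = 0 := by
      rw [Category.assoc, ← hb, ← hi]
      simp only [Category.assoc, reassoc_of% hl, reassoc_of% hz, zero_comp, comp_zero]
    obtain ⟨t, ht⟩ := hker (l ≫ a) hlb
    have hl' : t ≫ relCommToKerInfComm P p.π = l := by
      rw [← cancel_mono a, Category.assoc, hra, ht]
    rw [← cancel_epi e, ← hl, ← hl', Category.assoc, cokernel.condition, comp_zero, comp_zero]
  have : IsIso i := isIso_of_mono_of_strongEpi i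
  exact ⟨asIso i⟩

end Presentation

end Presentation

/-! ### Abelian objects and normal extensions with perfect domain -/

section Abelian

variable {𝒜 : Type u} [Category.{v} 𝒜] [HasZeroMorphisms 𝒜] [SemiAbelian 𝒜]

/-- The coordinate inclusions of a product are jointly epimorphic. -/
lemma prod_hom_ext_inclusions {X Y Z : 𝒜} {a b : X ⨯ Y ⟶ Z}
    (h₁ : prod.lift (𝟙 X) 0 ≫ a = prod.lift (𝟙 X) 0 ≫ b)
    (h₂ : prod.lift 0 (𝟙 Y) ≫ a = prod.lift 0 (𝟙 Y) ≫ b) : a = b := by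
  refine eq_of_kernel_of_section prod.fst (prod.lift (𝟙 X) 0) (by simp) (fun S z hz => ?_) h₁
  have : z = (z ≫ prod.snd) ≫ prod.lift 0 (𝟙 Y) := by
    apply prod.hom_ext <;> simp [hz]
  rw [this]
  simp only [Category.assoc, h₂]

/-- An object with a subtraction `d`, satisfying `d(x, x) = 0` and `d(x, 0) = x`, is an internal
abelian group. -/
lemma abelianObjects_of_subtraction {K : 𝒜} (d : K ⨯ K ⟶ K) (h₁ : prod.lift (𝟙 K) (𝟙 K) ≫ d = 0)
    (h₂ : prod.lift (𝟙 K) 0 ≫ d = 𝟙 K) : abelianObjects 𝒜 K := by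
  let D : ∀ {T : 𝒜}, (T ⟶ K) → (T ⟶ K) → (T ⟶ K) := fun x y => prod.lift x y ≫ d
  have hD : ∀ {T T' : 𝒜} (t : T' ⟶ T) (x y : T ⟶ K), t ≫ D x y = D (t ≫ x) (t ≫ y) :=
    fun t x y => by simp only [D, ← Category.assoc, prod.comp_lift]
  have D_self : ∀ {T : 𝒜} (x : T ⟶ K), D x x = 0 := fun x => by
    have := hD x (𝟙 K) (𝟙 K)
    rw [Category.comp_id] at this
    rw [← this]
    simp only [D, h₁, comp_zero]
  have D_zero : ∀ {T : 𝒜} (x : T ⟶ K), D x 0 = x := fun x => by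
    have := hD x (𝟙 K) 0
    rw [Category.comp_id, comp_zero] at this
    rw [← this]
    simp only [D, h₂, Category.comp_id]
  -- Read `D` as subtraction: `(x - y) - (0 - y) = x`. This and the group laws below are checked on
  -- coordinate inclusions, where one argument is zero.
  have D_D : ∀ {T : 𝒜} (x y : T ⟶ K), D (D x y) (D 0 y) = x := fun {T} x y => by
    have : D (D prod.fst prod.snd) (D 0 prod.snd) = (prod.fst : K ⨯ K ⟶ K) :=
      prod_hom_ext_inclusions (by simp [hD, D_zero]) (by simp [hD, D_self])
    simpa [hD] using prod.lift x y ≫= this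
  have D_zero_zero : ∀ {T : 𝒜} (y : T ⟶ K), D 0 (D 0 y) = y := fun y => by
    simpa only [D_self] using D_D y y
  let m : ∀ {T : 𝒜}, (T ⟶ K) → (T ⟶ K) → (T ⟶ K) := fun x y => D x (D 0 y)
  have hm : ∀ {T T' : 𝒜} (t : T' ⟶ T) (x y : T ⟶ K), t ≫ m x y = m (t ≫ x) (t ≫ y) :=
    fun t x y => by simp only [m, hD, comp_zero]
  have m_zero : ∀ {T : 𝒜} (x : T ⟶ K), m x 0 = x := fun x => by simp only [m, D_zero]
  have zero_m : ∀ {T : 𝒜} (x : T ⟶ K), m 0 x = x := fun x => D_zero_zero x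
  have m_comm : ∀ {T : 𝒜} (x y : T ⟶ K), m x y = m y x := fun x y => by
    have : m prod.fst prod.snd = m prod.snd (prod.fst : K ⨯ K ⟶ K) :=
      prod_hom_ext_inclusions (by simp [hm, m_zero, zero_m]) (by simp [hm, m_zero, zero_m])
    simpa [hm] using prod.lift x y ≫= this
  have m_assoc : ∀ {T : 𝒜} (x y z : T ⟶ K), m (m x y) z = m x (m y z) := fun x y z => by
    have : m (m (prod.fst ≫ prod.fst) (prod.fst ≫ prod.snd)) prod.snd =
        m (prod.fst ≫ prod.fst) (m (prod.fst ≫ prod.snd) (prod.snd : (K ⨯ K) ⨯ K ⟶ K)) :=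
      prod_hom_ext_inclusions (by simp [hm, m_zero]) (by simp [hm, zero_m])
    simpa [hm] using prod.lift (prod.lift x y) z ≫= this
  let grp (T : 𝒜) : CommGroup (T ⟶ K) :=
    { mul := m
      one := 0
      inv := D 0
      mul_assoc := m_assoc
      one_mul := zero_m
      mul_one := m_zero
      mul_comm := m_comm
      inv_mul_cancel := fun x => by
        change m (D 0 x) x = 0
        rw [m_comm]
        simp only [m, D_zero_zero, D_self] }
  let F : 𝒜ᵒᵖ ⥤ CommGrpCat.{v} :=
    { obj := fun T => @CommGrpCat.of (T.unop ⟶ K) (grp T.unop)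
      map := fun {T T'} f =>
        letI := grp T.unop
        letI := grp T'.unop
        CommGrpCat.ofHom
          { toFun := fun x => f.unop ≫ x
            map_one' := comp_zero
            map_mul' := fun x y => hm f.unop x y }
      map_id := fun T => by
        ext x
        exact Category.id_comp _
      map_comp := fun f g => by
        ext x
        exact Category.assoc _ _ _ }
  let α : (F ⋙ forget _).RepresentableBy K :=
    { homEquiv := Equiv.refl _
      homEquiv_comp := fun f g => rfl }
  let : CartesianMonoidalCategory 𝒜 := CartesianMonoidalCategory.ofHasFiniteProducts
  let : BraidedCategory 𝒜 := BraidedCategory.ofCartesianMonoidalCategory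
  let G := CommGrpObj.ofRepresentableBy K F α
  exact ⟨G.toGrpObj, G.toIsCommMonObj⟩

lemma abelianObjects_of_isZero {Y : 𝒜} (hY : IsZero Y) : abelianObjects 𝒜 Y :=
  abelianObjects_of_subtraction 0 (hY.eq_of_tgt _ _) (hY.eq_of_tgt _ _)

/-- A normal extension with perfect domain is central with respect to the abelian objects: the
diagonal of its kernel pair is normal. -/
lemma IsNormalMor.isCentralExt_abelianObjects {𝒞 : ObjectProperty 𝒜} [IsBirkhoff 𝒞]
    (hAb : abelianObjects 𝒜 ≤ 𝒞) {B A : 𝒜} {f : B ⟶ A} (hf : IsRegularEpi f)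
    (h : IsNormalMor 𝒞 f) (hB : InComm 𝒞 (𝟙 B)) : IsCentralExt (abelianObjects 𝒜) f := by
  obtain ⟨O, hO⟩ := HasZeroObject.zero (C := 𝒜)
  let ρ := reflUnit 𝒞 (pullback f f)
  let δ : B ⟶ pullback f f := pullback.lift (𝟙 B) (𝟙 B) rfl
  have hδ : δ ≫ ρ = 0 := inComm_iff.1 (by simpa using hB.comp δ)
  -- By normality the commutators of the kernel pair lie on the diagonal; since `B` is perfect, the
  -- whole diagonal is a commutator. So the kernel pair is the product of `B` and its reflection.
  have sq : IsPullback (pullback.fst f f) ρ (0 : B ⟶ O) 0 := by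
    refine isPullback_of_existsUnique (hO.eq_of_tgt _ _) (isRegularEpi_reflUnit 𝒞 _)
      (isRegularEpi_of_section _ 0 (hO.eq_of_tgt _ _)) fun S y _ => ?_
    refine ⟨y ≫ δ, ⟨(Category.assoc _ _ _).trans ((y ≫= hδ).trans comp_zero), by simp [δ]⟩, ?_⟩
    rintro x ⟨hx, rfl⟩
    have := h _ _ x pullback.condition (inComm_iff.2 hx)
    apply pullback.hom_ext
    · simp [δ]
    · simp [δ, this]
  obtain ⟨hQ, hρ⟩ := isReflection_reflUnit 𝒞 (pullback f f)
  let i := sq.lift 0 (𝟙 _) (hO.eq_of_tgt _ _)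
  have hi₁ : i ≫ pullback.fst f f = 0 := sq.lift_fst _ _ _
  have hi₂ : i ≫ ρ = 𝟙 _ := sq.lift_snd _ _ _
  let k := i ≫ pullback.snd f f
  have hk : k ≫ f = 0 := by
    rw [Category.assoc, ← pullback.condition, reassoc_of% hi₁, zero_comp]
  -- `i` embeds the reflection as the pairs `(0, k)`. The map `(a, b) ↦ ρ(k b, k a)` is a
  -- subtraction: it kills the diagonal, and the swapped order gives `d(a, 0) = ρ(i a) = a`.
  let d := pullback.lift (prod.snd ≫ k) (prod.fst ≫ k) (by simp [hk]) ≫ ρ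
  have hQab : abelianObjects 𝒜 ((reflection 𝒞).obj (pullback f f)) := by
    refine abelianObjects_of_subtraction d ?_ ?_
    · have : prod.lift (𝟙 _) (𝟙 _) ≫ pullback.lift (prod.snd ≫ k) (prod.fst ≫ k) (by simp [hk]) =
          k ≫ δ := by
        apply pullback.hom_ext <;> simp [δ]
      rw [reassoc_of% this, hδ, comp_zero]
    · have : prod.lift (𝟙 _) 0 ≫ pullback.lift (prod.snd ≫ k) (prod.fst ≫ k) (by simp [hk]) =
          i := by
        apply pullback.hom_ext <;> simp [k, hi₁]
      rw [reassoc_of% this, hi₂]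
  exact ⟨hf, B, f, hf, inferInstance, _, _, ρ, 0, 0, ⟨hQab, fun Z hZ g => hρ (hAb _ hZ) g⟩,
    isReflection_zero (hB.anti hAb) hO (abelianObjects_of_isZero hO), sq⟩

end Abelian

/-! ### Birkhoff subcategories of semi-abelian categories are semi-abelian -/

section FullSubcategory

lemma inComm_within {𝒜 : Type u} [Category.{v} 𝒜] [HasZeroMorphisms 𝒜] {𝒞 ℬ : ObjectProperty 𝒜}
    (hCB : 𝒞 ≤ ℬ) {S T : ℬ.FullSubcategory} {k : S ⟶ T} :
    InComm (within 𝒞 ℬ) k ↔ InComm 𝒞 k.hom := by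
  refine ⟨fun h Z hZ g => ?_, fun h Z hZ g => ?_⟩
  · exact congrArg (fun q => q.hom) (h (Z := ⟨Z, hCB _ hZ⟩) hZ (ObjectProperty.homMk g))
  · ext
    exact h hZ g.hom

variable {𝒜 : Type u} [Category.{v} 𝒜] [HasZeroMorphisms 𝒜] [SemiAbelian 𝒜]
  (ℬ : ObjectProperty 𝒜) [IsBirkhoff ℬ]

instance : ℬ.ι.PreservesZeroMorphisms where
  map_zero _ _ := rfl

variable {ℬ}

/-- The image computed in `𝒜` is a subobject of `Y`, hence lies in `ℬ`, where its inclusion must be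
invertible. -/
lemma isRegularEpi_hom {X Y : ℬ.FullSubcategory} {f : X ⟶ Y} (hf : IsRegularEpi f) :
    IsRegularEpi f.hom := by
  let F := Regular.strongEpiMonoFactorisation f.hom
  have hI : ℬ F.I := ℬ.prop_of_mono F.m Y.property
  let e : X ⟶ ⟨F.I, hI⟩ := ObjectProperty.homMk F.e
  let m : (⟨F.I, hI⟩ : ℬ.FullSubcategory) ⟶ Y := ObjectProperty.homMk F.m
  have hfac : e ≫ m = f := by ext; exact F.fac
  have : Mono m := ⟨fun a b h => by
    ext
    rw [← cancel_mono F.m]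
    exact congrArg (fun q => q.hom) h⟩
  have : StrongEpi m := by
    have : StrongEpi (e ≫ m) := by rw [hfac]; infer_instance
    exact strongEpi_of_strongEpi e m
  have : IsIso m := isIso_of_mono_of_strongEpi m
  have : IsIso F.m := inferInstanceAs (IsIso (ℬ.ι.map m))
  rw [← F.fac]
  exact isRegularEpi_comp (by dsimp only [F]; infer_instance) inferInstance

lemma isRegularEpi_of_hom {X Y : ℬ.FullSubcategory} {f : X ⟶ Y} (hf : IsRegularEpi f.hom) :
    IsRegularEpi f := by
  have : Epi f := ⟨fun a b h => by
    ext
    rw [← cancel_epi f.hom]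
    exact congrArg (fun q => q.hom) h⟩
  have sq : IsKernelPair f.hom (pullback.fst f f).hom (pullback.snd f f).hom :=
    (IsPullback.of_hasPullback f f).map ℬ.ι
  refine IsRegularEpi.of_epi_of_exists fun Z g hg => ?_
  let s := Cofork.ofπ (f := (pullback.fst f f).hom) g.hom (congrArg (fun q => q.hom) hg)
  exact ⟨ObjectProperty.homMk (sq.toCoequalizer'.desc s), by
    ext
    exact sq.toCoequalizer'.fac s WalkingParallelPair.one⟩

/-- The image of `(a, b)` in the product lies in `ℬ`. This replaces test objects from `𝒜` by test
objects from `ℬ`. -/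
lemma exists_epi_factorThru_fullSubcategory {T : 𝒜} {X Y : ℬ.FullSubcategory} (a : T ⟶ X.obj)
    (b : T ⟶ Y.obj) : ∃ (T' : ℬ.FullSubcategory) (e : T ⟶ T'.obj) (a' : T' ⟶ X) (b' : T' ⟶ Y),
      Epi e ∧ e ≫ a'.hom = a ∧ e ≫ b'.hom = b := by
  have hprod : ℬ (X.obj ⨯ Y.obj) :=
    ℬ.prop_of_iso (asIso (prodComparison ℬ.ι X Y)) (X ⨯ Y).property
  let F := Regular.strongEpiMonoFactorisation (prod.lift a b)
  refine ⟨⟨F.I, ℬ.prop_of_mono F.m hprod⟩, F.e, ObjectProperty.homMk (F.m ≫ prod.fst),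
    ObjectProperty.homMk (F.m ≫ prod.snd), by dsimp only [F]; infer_instance, ?_, ?_⟩
  · change F.e ≫ F.m ≫ prod.fst = a
    rw [← Category.assoc, F.fac, prod.lift_fst]
  · change F.e ≫ F.m ≫ prod.snd = b
    rw [← Category.assoc, F.fac, prod.lift_snd]

variable (ℬ)

instance regular_fullSubcategory : Regular ℬ.FullSubcategory where
  hasCoequalizer_of_isKernelPair _ := inferInstance
  regularEpiIsStableUnderBaseChange :=
    ⟨fun sq hg => isRegularEpi_of_hom
      (Regular.regularEpiIsStableUnderBaseChange.of_isPullback (sq.map ℬ.ι) (isRegularEpi_hom hg))⟩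

instance semiAbelian_fullSubcategory : SemiAbelian ℬ.FullSubcategory where
  hasZeroObject := by
    obtain ⟨O, hO⟩ := HasZeroObject.zero (C := 𝒜)
    refine ⟨⟨O, IsBirkhoff.prop_of_isZero ℬ hO⟩, ?_⟩
    rw [IsZero.iff_id_eq_zero]
    ext
    exact hO.eq_of_src _ _
  regular := inferInstance
  isKernelPair_of_isEquivalenceRelation R X p₁ p₂ h := by
    obtain ⟨⟨h⟩⟩ := h
    have hmono : JointlyMono₂ p₁.hom p₂.hom := ⟨fun T a b h₁ h₂ => by
      obtain ⟨T', e, a', b', he, rfl, rfl⟩ := exists_epi_factorThru_fullSubcategory a b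
      have : a' = b' := by
        apply h.right_cancellation <;> ext <;> rw [← cancel_epi e]
        · simpa using h₁
        · simpa using h₂
      rw [this]⟩
    -- Joint monicity and reflexivity suffice for an equivalence relation in `𝒜`. The image of `f`
    -- is a regular quotient of `X`, so it lies in `ℬ`.
    obtain ⟨Y, f, hf⟩ := SemiAbelian.isKernelPair_of_isEquivalenceRelation _ _
      (isEquivalenceRelation_of_reflexive hmono h.r.hom
        (congrArg (fun q => q.hom) h.reflexivity₁) (congrArg (fun q => q.hom) h.reflexivity₂))
    let F := Regular.strongEpiMonoFactorisation f
    have hFe : IsRegularEpi F.e := by dsimp only [F]; infer_instance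
    let g : X ⟶ (⟨F.I, IsBirkhoff.of_isRegularEpi F.e hFe X.property⟩ : ℬ.FullSubcategory) :=
      ObjectProperty.homMk F.e
    have hg : IsKernelPair F.e p₁.hom p₂.hom := by
      have hf' : IsKernelPair (F.e ≫ F.m) p₁.hom p₂.hom := by rwa [F.fac]
      exact hf'.cancel_right_of_mono
    exact ⟨_, g, IsPullback.of_map ℬ.ι (by ext; exact hg.w) hg⟩
  shortFive B' A' B A f' f b a w hf' hf ha hk := by
    have h := kernel_map_comp_preserves_kernel_iso_inv ℬ.ι f' f b a w
    have : IsIso (kernel.map (ℬ.ι.map f') (ℬ.ι.map f) (ℬ.ι.map b) (ℬ.ι.map a)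
        (by rw [← ℬ.ι.map_comp, w, ℬ.ι.map_comp])) := by
      have : IsIso (kernel.map (ℬ.ι.map f') (ℬ.ι.map f) (ℬ.ι.map b) (ℬ.ι.map a)
          (by rw [← ℬ.ι.map_comp, w, ℬ.ι.map_comp]) ≫ (PreservesKernel.iso ℬ.ι f).inv) := by
        rw [h]
        infer_instance
      exact IsIso.of_isIso_comp_right _ (PreservesKernel.iso ℬ.ι f).inv
    have := SemiAbelian.shortFive (ℬ.ι.map f') (ℬ.ι.map f) (ℬ.ι.map b) (ℬ.ι.map a) _
      (isRegularEpi_hom hf') (isRegularEpi_hom hf) inferInstance this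
    exact isIso_of_reflects_iso b ℬ.ι
  hasBinaryCoproducts := by
    let _ : Reflective ℬ.ι := { L := ℬ.ι.leftAdjoint, adj := Adjunction.ofIsRightAdjoint ℬ.ι }
    exact hasColimitsOfShape_of_reflective ℬ.ι

variable {ℬ} {𝒞 : ObjectProperty 𝒜}

lemma isNormalMor_within (hCB : 𝒞 ≤ ℬ) {B A : ℬ.FullSubcategory} {f : B ⟶ A} :
    IsNormalMor (within 𝒞 ℬ) f ↔ IsNormalMor 𝒞 f.hom := by
  refine ⟨fun h S T x y k hxy hk => ?_, fun h S T x y k hxy hk => ?_⟩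
  · obtain ⟨T', e, x', y', he, rfl, rfl⟩ := exists_epi_factorThru_fullSubcategory x y
    obtain ⟨S', e', k', -, he', hk', -⟩ :=
      exists_epi_factorThru_fullSubcategory (k ≫ e) (k ≫ e)
    have hxy' : x' ≫ f = y' ≫ f := by
      ext
      simpa [← cancel_epi e] using hxy
    have hk'' : InComm (within 𝒞 ℬ) k' := by
      rw [inComm_within hCB]
      exact InComm.of_epi e' (hk' ▸ hk.comp e)
    have := congrArg (fun q => q.hom) (h x' y' k' hxy' hk'')
    rw [← reassoc_of% hk', ← reassoc_of% hk']
    exact e' ≫= this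
  · ext
    exact h x.hom y.hom k.hom (congrArg (fun q => q.hom) hxy) ((inComm_within hCB).1 hk)

lemma isCentralExt_within [IsBirkhoff 𝒞] (hCB : 𝒞 ≤ ℬ) {B A : ℬ.FullSubcategory} {f : B ⟶ A} :
    IsCentralExt (within 𝒞 ℬ) f ↔ IsCentralExt 𝒞 f.hom := by
  rw [isCentralExt_iff, isCentralExt_iff, isNormalMor_within hCB]
  exact and_congr_left' ⟨isRegularEpi_hom, isRegularEpi_of_hom⟩

end FullSubcategory

/-! ### Comparison of universal central extensions -/

section Comparison

variable {𝒜 : Type u} [Category.{v} 𝒜]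

lemma IsUniversalCentralExt.exists_iso [HasPullbacks 𝒜] {P : ObjectProperty 𝒜} {U V A : 𝒜}
    {u : U ⟶ A} {w : V ⟶ A} (hu : IsUniversalCentralExt P u) (hw : IsUniversalCentralExt P w) :
    ∃ e : U ≅ V, e.hom ≫ w = u := by
  obtain ⟨a, ha, -⟩ := hu.2 w hw.1
  obtain ⟨b, hb, -⟩ := hw.2 u hu.1
  exact ⟨⟨a, b, (hu.2 u hu.1).unique (by rw [Category.assoc, hb, ha]) (Category.id_comp _),
    (hw.2 w hw.1).unique (by rw [Category.assoc, ha, hb]) (Category.id_comp _)⟩, ha⟩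

lemma IsUniversalCentralExt.of_iso [HasPullbacks 𝒜] {P : ObjectProperty 𝒜} {U V A : 𝒜}
    {u : U ⟶ A} {w : V ⟶ A} (hw : IsUniversalCentralExt P w) (e : U ≅ V) (he : e.hom ≫ w = u)
    (hu : IsCentralExt P u) : IsUniversalCentralExt P u := by
  refine ⟨hu, fun B f hf => ?_⟩
  obtain ⟨h, hh, huniq⟩ := hw.2 f hf
  refine ⟨e.hom ≫ h, by simp [hh, he], fun y hy => ?_⟩
  rw [← huniq (e.inv ≫ y) (by simp [hy, ← he]), e.hom_inv_id_assoc]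

variable [HasZeroMorphisms 𝒜] [SemiAbelian 𝒜] {𝒞 ℬ : ObjectProperty 𝒜} [IsBirkhoff 𝒞]
  [IsBirkhoff ℬ]

/-- The reflection in `ℬ` of a perfect universal `𝒞`-central extension of an object of `ℬ` is a
universal `𝒞`-central extension in `ℬ`. -/
lemma IsUniversalCentralExt.within_of_reflUnit (hCB : 𝒞 ≤ ℬ) {B : ℬ.FullSubcategory} {W : 𝒜}
    {w : W ⟶ B.obj} (hw : IsUniversalCentralExt 𝒞 w)
    {U : ℬ.FullSubcategory} {u : U ⟶ B} (h : W ⟶ U.obj) (hr : IsReflection ℬ h)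
    (hu : h ≫ u.hom = w) : IsUniversalCentralExt (within 𝒞 ℬ) u := by
  have hepi : IsRegularEpi h := by
    obtain ⟨a, ha, -⟩ := (isReflection_reflUnit ℬ W).2 hr.1 h
    obtain ⟨b, hb, -⟩ := hr.2 (isReflection_reflUnit ℬ W).1 (reflUnit ℬ W)
    have hba : b ≫ a = 𝟙 _ := (hr.2 hr.1 h).unique (by rw [← Category.assoc, hb, ha])
      (Category.comp_id _)
    rw [← ha]
    exact isRegularEpi_comp (isRegularEpi_reflUnit ℬ W) (isRegularEpi_of_section a b hba)
  obtain ⟨hwr, hwn⟩ := isCentralExt_iff.1 hw.1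
  rw [← hu] at hwr hwn
  refine ⟨(isCentralExt_within hCB).2
    (isCentralExt_iff.2 ⟨isRegularEpi_of_comp hwr, hwn.of_regularEpi_comp hepi⟩), fun E f hf => ?_⟩
  -- A central extension in `ℬ` is central in `𝒜`, so `w` maps to it; its domain is in `ℬ`, so the
  -- map factors through `h`.
  obtain ⟨k, hk, hkuniq⟩ := hw.2 f.hom ((isCentralExt_within hCB).1 hf)
  obtain ⟨l, hl, -⟩ := hr.2 E.property k
  refine ⟨ObjectProperty.homMk l, ?_, fun y hy => ?_⟩
  · ext
    rw [← cancel_epi h]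
    change h ≫ l ≫ f.hom = h ≫ u.hom
    rw [reassoc_of% hl, hk, hu]
  · ext
    rw [← cancel_epi h]
    change h ≫ y.hom = h ≫ l
    rw [hl]
    refine hkuniq _ ((Category.assoc _ _ _).trans ?_)
    rw [← hu]
    exact congrArg (fun q => h ≫ q.hom) hy

/-- Under condition (UCE), normal extensions between perfect objects compose. -/
lemma ConditionUCE.isCentralExt_comp (hUCE : ConditionUCE 𝒜) (hAb : abelianObjects 𝒜 ≤ 𝒞)
    {C B A : 𝒜} {g : C ⟶ B} {f : B ⟶ A} (hC : InComm 𝒞 (𝟙 C)) (hB : InComm 𝒞 (𝟙 B))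
    (hf : IsCentralExt 𝒞 f) (hg : IsCentralExt 𝒞 g) : IsCentralExt 𝒞 (g ≫ f) := by
  obtain ⟨O, hO⟩ := HasZeroObject.zero (C := 𝒜)
  -- Both factors have perfect domain, so they are central for the abelian objects; the composite is
  -- returned to `𝒞` by `hAb`.
  have h := hUCE g f
    ⟨O, 0, isReflection_zero (hB.anti hAb) hO (abelianObjects_of_isZero hO), hO⟩
    ((hf.isNormalMor le_rfl).isCentralExt_abelianObjects hAb hf.1 hB)
    ((hg.isNormalMor le_rfl).isCentralExt_abelianObjects hAb hg.1 hC)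
  exact (h.isNormalMor hAb).isCentralExt h.1

/-- If `w = v ≫ q` and `t` are universal central extensions with perfect domains, and `t ≫ q` is
central, then `v` and `t` are isomorphic. -/
lemma IsUniversalCentralExt.exists_iso_of_comp {W T Q B : 𝒜} {v : W ⟶ Q} {q : Q ⟶ B} {t : T ⟶ Q}
    (hW : InComm 𝒞 (𝟙 W)) (hT : InComm 𝒞 (𝟙 T)) (hw : IsUniversalCentralExt 𝒞 (v ≫ q))
    (ht : IsUniversalCentralExt 𝒞 t) (hv : IsRegularEpi v) (hq : IsNormalMor 𝒞 q)
    (htq : IsCentralExt 𝒞 (t ≫ q)) : ∃ e : W ≅ T, e.hom ≫ t = v := by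
  have hvc : IsCentralExt 𝒞 v :=
    isCentralExt_iff.2 ⟨hv, (hw.1.isNormalMor le_rfl).of_comp⟩
  obtain ⟨a, ha, -⟩ := hw.2 (t ≫ q) htq
  obtain ⟨b, hb, -⟩ := ht.2 v hvc
  -- A priori `a` is a map over `B` only; `W` is perfect and `q` normal, so it is one over `Q`.
  have hat : a ≫ t = v := hq.eq_of_perfect hW (by rw [Category.assoc, ha])
  exact ⟨⟨a, b, (hvc.isNormalMor le_rfl).eq_of_perfect hW (by simp [hat, hb]),
    (ht.1.isNormalMor le_rfl).eq_of_perfect hT (by simp [hat, hb])⟩, hat⟩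

lemma isZero_kernel_iff_isIso {X Y : 𝒜} {f : X ⟶ Y} (hf : IsRegularEpi f) :
    IsZero (kernel f) ↔ IsIso f := by
  refine ⟨fun h => ?_, fun h => ?_⟩
  · have : Mono f := mono_of_forall_eq_zero f fun S z hz => by
      rw [← kernel.lift_ι f z hz, h.eq_zero_of_tgt (kernel.lift f z hz), zero_comp]
    exact isIso_of_mono_of_strongEpi f
  · rw [IsZero.iff_id_eq_zero, ← cancel_mono (kernel.ι f), ← cancel_mono f]
    simp

end Comparison

end CentralExt

/-! ### The main theorem -/

theorem mainTheorem10 {𝒜 : Type u} [Category.{v} 𝒜] [HasZeroMorphisms 𝒜] [SemiAbelian 𝒜]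
    [EnoughRegularProjectives 𝒜] (hUCE : ConditionUCE 𝒜)
    (𝒞 ℬ : ObjectProperty 𝒜) [IsBirkhoff 𝒞] [IsBirkhoff ℬ]
    (hAb : abelianObjects 𝒜 ≤ 𝒞) (hCB : 𝒞 ≤ ℬ)
    (B : ℬ.FullSubcategory) (hB : IsPerfect (within 𝒞 ℬ) B)
    (p : Presentation B.obj) (q : Presentation B)
    (r : Presentation (q.U (within 𝒞 ℬ)).obj) :
    IsUniversalCentralExt 𝒞 (p.u 𝒞) ∧
    IsUniversalCentralExt (within 𝒞 ℬ) (q.u (within 𝒞 ℬ)) ∧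
    (∃ θ : (reflection ℬ).obj (p.U 𝒞) ≅ (q.U (within 𝒞 ℬ)).obj,
      reflUnit ℬ (p.U 𝒞) ≫ θ.hom ≫ (q.u (within 𝒞 ℬ)).hom = p.u 𝒞 ∧
      IsUniversalCentralExt 𝒞 (reflUnit ℬ (p.U 𝒞) ≫ θ.hom) ∧
      ∃ e : p.U 𝒞 ≅ r.U 𝒞, e.hom ≫ r.u 𝒞 = reflUnit ℬ (p.U 𝒞) ≫ θ.hom) ∧
    Nonempty (commObj ℬ (p.U 𝒞) ≅ r.H₂ 𝒞) ∧
    List.TFAE [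
      ∃ e : p.U 𝒞 ≅ (q.U (within 𝒞 ℬ)).obj, e.hom ≫ (q.u (within 𝒞 ℬ)).hom = p.u 𝒞,
      IsIso (reflUnit ℬ (p.U 𝒞)),
      IsZero (r.H₂ 𝒞)] := by
  have hBJ := hB.inComm
  have hBI : InComm 𝒞 (𝟙 B.obj) := (inComm_within hCB).1 hBJ
  have hQJ := q.inComm_U hBJ
  have hQ : InComm 𝒞 (𝟙 (q.U (within 𝒞 ℬ)).obj) := (inComm_within hCB).1 hQJ
  have hp := p.isUniversalCentralExt_u hBI
  have hq := q.isUniversalCentralExt_u hBJ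
  have hr := r.isUniversalCentralExt_u hQ
  have hη := isReflection_reflUnit ℬ (p.U 𝒞)
  have hηr := isRegularEpi_reflUnit ℬ (p.U 𝒞)
  obtain ⟨s, hs, -⟩ := hη.2 B.property (p.u 𝒞)
  let S : ℬ.FullSubcategory := ⟨(reflection ℬ).obj (p.U 𝒞), hη.1⟩
  obtain ⟨θ', hθ'⟩ := (hp.within_of_reflUnit hCB (U := S) (u := ObjectProperty.homMk s)
    (reflUnit ℬ (p.U 𝒞)) hη hs).exists_iso hq
  let θ : (reflection ℬ).obj (p.U 𝒞) ≅ (q.U (within 𝒞 ℬ)).obj := ℬ.ι.mapIso θ'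
  have hθ : θ.hom ≫ (q.u (within 𝒞 ℬ)).hom = s := congrArg (fun x => x.hom) hθ'
  have hθu : reflUnit ℬ (p.U 𝒞) ≫ θ.hom ≫ (q.u (within 𝒞 ℬ)).hom = p.u 𝒞 := by rw [hθ, hs]
  have hqc : IsCentralExt 𝒞 (q.u (within 𝒞 ℬ)).hom := (isCentralExt_within hCB).1 hq.1
  have hv : IsRegularEpi (reflUnit ℬ (p.U 𝒞) ≫ θ.hom) := isRegularEpi_comp hηr inferInstance
  have hw : IsUniversalCentralExt 𝒞
      ((reflUnit ℬ (p.U 𝒞) ≫ θ.hom) ≫ (q.u (within 𝒞 ℬ)).hom) := by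
    rwa [Category.assoc, hθu]
  obtain ⟨e, he⟩ := IsUniversalCentralExt.exists_iso_of_comp (p.inComm_U hBI) (r.inComm_U hQ) hw hr
    hv (hqc.isNormalMor le_rfl)
    (hUCE.isCentralExt_comp hAb (r.inComm_U hQ) hQ hqc hr.1)
  have hvc : IsCentralExt 𝒞 (reflUnit ℬ (p.U 𝒞) ≫ θ.hom) :=
    isCentralExt_iff.2 ⟨hv, (hw.1.isNormalMor le_rfl).of_comp⟩
  obtain ⟨h₂⟩ := r.nonempty_H₂_iso_kernel 𝒞
  let φ : commObj ℬ (p.U 𝒞) ≅ r.H₂ 𝒞 :=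
    kernel.mapIso (reflUnit ℬ (p.U 𝒞)) (r.u 𝒞) e θ he.symm ≪≫ h₂.symm
  refine ⟨hp, hq, ⟨θ, hθu, hr.of_iso e he hvc, e, he⟩, ⟨φ⟩, ?_⟩
  -- The isomorphism puts `U(B, JI)` in `ℬ`, so its identity factors through the unit, which is
  -- therefore monic as well as a regular epimorphism.
  tfae_have 1 → 2 := fun ⟨e', _⟩ => by
    obtain ⟨k, hk, -⟩ := hη.2 (ℬ.prop_of_iso e'.symm (q.U (within 𝒞 ℬ)).property) (𝟙 _)
    have : Mono (reflUnit ℬ (p.U 𝒞)) := mono_of_mono_fac hk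
    exact isIso_of_mono_of_strongEpi _
  tfae_have 2 → 1 := fun _ => ⟨asIso (reflUnit ℬ (p.U 𝒞)) ≪≫ θ, by simpa using hθu⟩
  tfae_have 2 ↔ 3 := by
    rw [← isZero_kernel_iff_isIso hηr]
    exact φ.isZero_iff
  tfae_finish
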